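/- **Setting.** Let $\Sigma=\{1,\dots,\sigma\}$ with $\sigma\ge 2$, and let $\$=1$ be its smallest character. Let $T[1..n]$ be a text in which exactly the characters of $\Sigma$ occur, with $T[n]=\$$ and $\$$ not occurring in $T[1..n-1]$. The reversed text $T^{rev}[1..n]$ is given by $T^{rev}[n]=\$$ and $T^{rev}[i]=T[n-i]$ for $1\le i<n$. Let $\mathtt{SA}[1..n]$ be the suffix array of $T^{rev}$, that is, the permutation of $\{1,\dots,n\}$ for which the suffixes $T^{rev}[\mathtt{SA}[i]..n]$ are lexicographically increasing in $i$. Let $\mathtt{BWT}[i]=\$$ if $\mathtt{SA}[i]=1$, and $\mathtt{BWT}[i]=T^{rev}[\mathtt{SA}[i]-1]$ otherwise. Let $\mathtt{LCP}[1]=-1$ and, for $i>1$, let $\mathtt{LCP}[i]$ be the length of the longest common prefix of the reverses of $T[1..n-\mathtt{SA}[i]]$ and $T[1..n-\mathtt{SA}[i-1]]$. A (possibly empty) string $u$ is *right-maximal* in $T$ if $ua$ and $ub$ are substrings of $T$ for two distinct characters $a,b$. A set $X\subseteq\{1,\dots,n\}$ is *suffixient* for $T$ if for every right-maximal $u$ and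 every character $c$ such that $uc$ is a substring of $T$, there is an $x\in X$ such that $uc$ is a suffix of $T[1..x]$. A *suffixient array* of $T$ is a suffixient set for $T$ of minimum size, listed in increasing co-lexicographic order of the prefixes $T[1..x]$ (the lexicographic order of the reversed strings). Let $\chi$ be its size, and let $h$ be the height of the suffix tree of $T^{rev}$, that is, the maximum number of branching nodes on a root-to-leaf path. **Machine.** The machine is a unit-cost random access machine with direct and indirect addressing, addition, subtraction and comparisons, and with a write-only output tape. The arrays $\mathtt{BWT},\mathtt{SA},\mathtt{LCP}$ are read in one pass with one-step look-ahead: the input head starts at index $1$ and only moves forward, and when it is at index $i$ the entries with index $i$ and $i+1$ can be read (reading beyond index $n$ gives $-1$). Initially two memory cells hold $n$ and $\sigma$, and all other cells hold $0$. **Theorem.** There are a fixed program and a constant $C$ such that, for every $\sigma$ and every text $T[1..n]$ as above, the program, run on the arrays $\mathtt{BWT},\mathtt{SA},\mathtt{LCP}$ of the reversed text, halts after at most $Cn$ steps and outputs a suffixient array of $T$. It uses, besides the input arrays and the output tape (which receives exactly $\chi$ words), only the memory cells with addresses less than $C(\chi+h)$, and every number stored in memory has absolute value at most $Cn$. -/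

import Mathlib

namespace Suffixient

/-! ### Texts, arrays of the reversed text, suffixient arrays

Strings are lists over the alphabet `{1, …, σ}`; positions in texts and indices in arrays are
`1`-based.  Thus `T[1..x]` is `T.take x`, and "`u` is a substring / prefix / suffix of `v`" is
`u <:+: v` / `u <+: v` / `u <:+ v`.  The order `<` on lists is the lexicographic one. -/

/-- The sentinel character `$`, the smallest character of the alphabet. -/
def sentinel : ℕ := 1

/-- `T` is a text over the alphabet `{1, …, σ}`, `σ ≥ 2`: its set of characters is exactly
`{1, …, σ}`, it ends with the sentinel, and the sentinel occurs nowhere else. -/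
def IsText (σ : ℕ) (T : List ℕ) : Prop :=
  2 ≤ σ ∧ (∀ c, c ∈ T ↔ 1 ≤ c ∧ c ≤ σ) ∧ ∃ U : List ℕ, T = U ++ [sentinel] ∧ sentinel ∉ U

/-- The reversed text: everything before the final sentinel is reversed, the sentinel stays
last. -/
def revText (T : List ℕ) : List ℕ := T.dropLast.reverse ++ [sentinel]

/-- `SA[1..n]` is the suffix array of the string `R` of length `n`: a permutation of `{1, …, n}`
that lists the suffixes `R[SA[i]..n]` in increasing lexicographic order.  (Values of `SA` outside
`[1..n]` are irrelevant.) -/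
def IsSuffixArray (R : List ℕ) (SA : ℕ → ℕ) : Prop :=
  Set.BijOn SA (Set.Icc 1 R.length) (Set.Icc 1 R.length) ∧
    ∀ i j, 1 ≤ i → i < j → j ≤ R.length → R.drop (SA i - 1) < R.drop (SA j - 1)

/-- `BWT[i]` of the reversed text: the character that precedes position `SA[i]`
(`$` if `SA[i] = 1`). -/
def bwt (T : List ℕ) (SA : ℕ → ℕ) (i : ℕ) : ℕ :=
  if SA i = 1 then sentinel else (revText T).getD (SA i - 2) 0

/-- Length of the longest common prefix of two strings. -/
def lcpLength : List ℕ → List ℕ → ℕ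
  | a :: s, b :: t => if a = b then lcpLength s t + 1 else 0
  | _, _ => 0

/-- `LCP[i]` of the reversed text: `LCP[1] = -1`, and for `i > 1` the length of the longest common
prefix of the reverses of `T[1..n - SA[i]]` and `T[1..n - SA[i-1]]`. -/
def lcp (T : List ℕ) (SA : ℕ → ℕ) (i : ℕ) : ℤ :=
  if i = 1 then -1
  else (lcpLength (T.take (T.length - SA i)).reverse
    (T.take (T.length - SA (i - 1))).reverse : ℤ)

/-- `u` is a right-maximal substring of `T`. -/
def RightMaximal (T u : List ℕ) : Prop :=
  ∃ a b : ℕ, a ≠ b ∧ u ++ [a] <:+: T ∧ u ++ [b] <:+: T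

/-- `X ⊆ {1, …, n}` is a suffixient set for `T`: every one-character right-maximal extension
`u ++ [c]` is a suffix of `T[1..x]` for some `x ∈ X`. -/
def IsSuffixient (T : List ℕ) (X : Finset ℕ) : Prop :=
  X ⊆ Finset.Icc 1 T.length ∧
    ∀ (u : List ℕ) (c : ℕ), RightMaximal T u → u ++ [c] <:+: T →
      ∃ x ∈ X, u ++ [c] <:+ T.take x

/-- Co-lexicographic order: lexicographic order of the reversed strings. -/
def ColexLT (α β : List ℕ) : Prop := α.reverse < β.reverse

/-- `A` is a suffixient array of `T`: a suffixient set of minimum size, listed (without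
repetition) in increasing co-lexicographic order of the prefixes `T[1..x]`. -/
def IsSuffixientArray (T : List ℕ) (A : List ℕ) : Prop :=
  IsSuffixient T A.toFinset ∧
    (∀ Y : Finset ℕ, IsSuffixient T Y → A.toFinset.card ≤ Y.card) ∧
    A.Pairwise fun x y => ColexLT (T.take x) (T.take y)

/-! ### Suffix trees

The suffix tree of `S` is the trie of the suffixes of `S` in which the nodes with exactly one
child are contracted.  A node is named by the string spelled on its path from the root, so the
ancestors of a node are its prefixes. -/

/-- `u` is a node of the trie of all suffixes of `S`. -/
def IsTrieNode (S u : List ℕ) : Prop := ∃ v, v <:+ S ∧ u <+: v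

/-- `u` is a branching node (at least two children). -/
def IsBranchingNode (S u : List ℕ) : Prop :=
  ∃ a b : ℕ, a ≠ b ∧ IsTrieNode S (u ++ [a]) ∧ IsTrieNode S (u ++ [b])

/-- `u` is a leaf. -/
def IsLeaf (S u : List ℕ) : Prop := IsTrieNode S u ∧ ∀ a : ℕ, ¬ IsTrieNode S (u ++ [a])

/-- The height of the suffix tree of `S`: the maximum number of branching nodes on a
root-to-leaf path. -/
noncomputable def suffixTreeHeight (S : List ℕ) : ℕ :=
  sSup {k | ∃ v, IsLeaf S v ∧ k = Set.ncard {u | u <+: v ∧ IsBranchingNode S u}}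

/-! ### The machine model

A random access machine with unit-cost instructions: direct and indirect addressing, addition,
subtraction, comparisons.  The three input arrays are on a read-only stream whose head only moves
forward; at head index `i` the machine may read the entries of index `i` and (look-ahead) of
index `i + 1`.  The output is written on a write-only tape.  The machine has `space` words of
memory, with addresses `0, …, space - 1`, and each word holds an integer of absolute value at most
`word`; an access outside the memory or the storing of too large a number is a fault, after which
the machine never halts. -/

/-- The three input arrays. -/
inductive InputArray
  | bwt
  | sa
  | lcp

/-- A memory location: the cell `a`, or the cell whose address is stored in the cell `a`. -/
inductive Loc
  | dir (a : ℕ)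
  | ind (a : ℕ)

/-- An operand: an integer constant or the content of a memory location. -/
inductive Operand
  | const (k : ℤ)
  | loc (x : Loc)

/-- Instructions.  `jumpLT x y l` / `jumpEQ x y l` go to instruction `l` if `x < y` / `x = y`;
`read A false d` and `read A true d` store the entry of `A` at the head index, resp. at the next
index, in `d`; `advance` moves the head to the next index; `write x` appends `x` to the output. -/
inductive Instr
  | move (d : Loc) (x : Operand)
  | add (d : Loc) (x y : Operand)
  | sub (d : Loc) (x y : Operand)
  | jumpLT (x y : Operand) (l : ℕ)
  | jumpEQ (x y : Operand) (l : ℕ)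
  | read (A : InputArray) (ahead : Bool) (d : Loc)
  | advance
  | write (x : Operand)
  | halt

/-- A program is a finite list of instructions, numbered from `0`. -/
abbrev Program := List Instr

/-- A state: program counter, memory, index of the input head, output written so far. -/
structure MState where
  pc : ℕ
  mem : ℕ → ℤ
  head : ℕ
  out : List ℤ

/-- The address a location refers to; `none` if an address outside the memory is accessed. -/
def Loc.address (space : ℕ) (m : ℕ → ℤ) : Loc → Option ℕ
  | .dir a => if a < space then some a else none
  | .ind a => if a < space ∧ 0 ≤ m a ∧ m a < (space : ℤ) then some (m a).toNat else none

/-- The value of an operand. -/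
def Operand.value (space : ℕ) (m : ℕ → ℤ) : Operand → Option ℤ
  | .const k => some k
  | .loc x => (x.address space m).map m

/-- Store `v` in `d` and go to the next instruction. -/
def store (space word : ℕ) (d : Loc) (v : ℤ) (s : MState) : Option MState :=
  if |v| ≤ (word : ℤ) then
    (d.address space s.mem).map fun a =>
      { s with pc := s.pc + 1, mem := Function.update s.mem a v }
  else none

/-- Execute one instruction; `none` on a fault (and for `halt`, which has no successor state). -/
def exec (inp : InputArray → ℕ → ℤ) (space word : ℕ) (s : MState) : Instr → Option MState
  | .move d x => (x.value space s.mem).bind fun v => store space word d v s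
  | .add d x y => (x.value space s.mem).bind fun v => (y.value space s.mem).bind fun w =>
      store space word d (v + w) s
  | .sub d x y => (x.value space s.mem).bind fun v => (y.value space s.mem).bind fun w =>
      store space word d (v - w) s
  | .jumpLT x y l => (x.value space s.mem).bind fun v => (y.value space s.mem).map fun w =>
      { s with pc := if v < w then l else s.pc + 1 }
  | .jumpEQ x y l => (x.value space s.mem).bind fun v => (y.value space s.mem).map fun w =>
      { s with pc := if v = w then l else s.pc + 1 }
  | .read A ahead d => store space word d (inp A (if ahead then s.head + 1 else s.head)) s
  | .advance => some { s with pc := s.pc + 1, head := s.head + 1 }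
  | .write x => (x.value space s.mem).map fun v => { s with pc := s.pc + 1, out := s.out ++ [v] }
  | .halt => none

/-- One step of the program `P`. -/
def step (P : Program) (inp : InputArray → ℕ → ℤ) (space word : ℕ) (s : MState) :
    Option MState :=
  (P[s.pc]?).bind fun I => exec inp space word s I

/-- The state after `t` steps. -/
def run (P : Program) (inp : InputArray → ℕ → ℤ) (space word : ℕ) : ℕ → MState → Option MState
  | 0, s => some s
  | t + 1, s => (step P inp space word s).bind fun s' => run P inp space word t s'

/-- The initial state: the cells `0` and `1` hold `n` and `σ`, all other cells hold `0`; the input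
head is at index `1`; nothing has been written. -/
def initialState (n σ : ℕ) : MState where
  pc := 0
  mem := fun a => if a = 0 then (n : ℤ) else if a = 1 then (σ : ℤ) else 0
  head := 1
  out := []

/-- `P`, started on the given input stream with `n` and `σ`, on a machine with `space` memory words
that hold integers of absolute value at most `word`, halts after at most `time` steps and its
output is `L`. -/
def Computes (P : Program) (inp : InputArray → ℕ → ℤ) (n σ time space word : ℕ)
    (L : List ℤ) : Prop :=
  ∃ t ≤ time, ∃ s, run P inp space word t (initialState n σ) = some s ∧
    P[s.pc]? = some Instr.halt ∧ s.out = L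

/-- The input stream: the arrays `BWT[1..n]`, `SA[1..n]`, `LCP[1..n]` of the reversed text;
reading beyond index `n` gives `-1`. -/
def inputStream (T : List ℕ) (SA : ℕ → ℕ) (A : InputArray) (i : ℕ) : ℤ :=
  if 1 ≤ i ∧ i ≤ T.length then
    match A with
    | .bwt => (bwt T SA i : ℤ)
    | .sa => (SA i : ℤ)
    | .lcp => lcp T SA i
  else -1

end Suffixient

/-!
Write `w i` for `revPrefix T SA i`, the reverse of `T[1..n - SA[i]]`; the `w i` are
lexicographically sorted, `BWT[i]` is the character that follows this prefix in `T`, and `LCP[i]` is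
the length of the longest common prefix of `w (i - 1)` and `w i`.  The strings `w i` that start with
the reverse of a given string form an interval of indices.  So `X` is suffixient if and only if it
hits each interval of a right-maximal string once for each character `c` of `BWT` on it, in an index
where `BWT` equals `c`.  An interval on which `BWT` takes the value `c` and another value contains a
boundary `j` of two runs of `BWT`, one of them a run of `c` (an *event* `(j, c)`), and with it the
*box* of `j`, the largest `[l, r]` with `l < j ≤ r` and `LCP ≥ LCP[j]` on `(l, r]`.
Hence it is enough to hit the boxes of events (`IsSuffixient.exists_inBox`,
`isSuffixient_of_inBox`), and a smallest suffixient set has one element for each character `c` and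
each inclusion-minimal box of an event of `c`.

These minimal boxes are found in one scan.  A stack holds the suffix minima of the `LCP` array read
so far (`IsMonoStack`).  Above its bottom the entries are branching nodes on one path of the suffix
tree, so its size is at most the height plus one (`IsMonoStack.depth_le_height`).  For each
character only the last candidate is remembered.  A new event `(j, c)` is ignored if the last
candidate of `c` lies in the box of `j`.  Otherwise it replaces that candidate if its box is still
open, that is, contains `j`, and is a new candidate if not (`IsCandidateList.skip`, `.replace`,
`.append`).  Whether the box is open is read off in constant time from the stack level at which the
box was opened (`IsDepthMark.open_iff`).  At any time the candidates of one character have disjoint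
boxes, so their number never exceeds the size of any suffixient set (`IsSuffixient.le_card`); this
gives both the space bound and the minimality of the output.

The candidates of one character are created in colexicographic order.  After the scan they are
prepended, the last one first, to a linked list for each character, and the lists are written one
character after the other.  Stack, characters and nodes are stored in interleaved records, so that
no bound on their numbers need be known in advance.  The running time is linear because each pop
is paid for by a push (`reach_next`).
-/

namespace Suffixient

/-! ### Monotone stacks -/

/-- The stack of suffix minima of `L[1..j]`: `idx 1 < ⋯ < idx D = j` (bottom to top) have
increasing `L`-values, and every index up to `j` has an entry at or after it with an `L`-value
at most its own. -/
structure IsMonoStack (L : ℕ → ℤ) (j D : ℕ) (idx : ℕ → ℕ) : Prop where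
  one_le : 1 ≤ D
  first : idx 1 = 1
  last : idx D = j
  idx_lt : ∀ d d', 1 ≤ d → d < d' → d' ≤ D → idx d < idx d'
  val_lt : ∀ d d', 1 ≤ d → d < d' → d' ≤ D → L (idx d) < L (idx d')
  cover : ∀ k, 1 ≤ k → k ≤ j → ∃ d, 1 ≤ d ∧ d ≤ D ∧ k ≤ idx d ∧ L (idx d) ≤ L k

namespace IsMonoStack

variable {L : ℕ → ℤ} {j D : ℕ} {idx : ℕ → ℕ}

lemma idx_le (h : IsMonoStack L j D idx) {d : ℕ} (h1 : 1 ≤ d) (h2 : d ≤ D) : idx d ≤ j := by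
  rcases h2.eq_or_lt with rfl | h2
  · exact h.last.le
  · exact h.last ▸ (h.idx_lt d D h1 h2 le_rfl).le

lemma le_idx (h : IsMonoStack L j D idx) {d : ℕ} (h1 : 1 ≤ d) (h2 : d ≤ D) : d ≤ idx d := by
  induction d, h1 using Nat.le_induction with
  | base => exact h.first.ge
  | succ d hd ih => have := h.idx_lt d (d + 1) hd (by omega) h2; have := ih (by omega); omega

lemma depth_le (h : IsMonoStack L j D idx) : D ≤ j := h.last ▸ h.le_idx h.one_le le_rfl

lemma val_lt_of_lt (h : IsMonoStack L j D idx) {d k : ℕ} (h1 : 1 ≤ d) (h2 : d ≤ D)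
    (hk : idx d < k) (hkj : k ≤ j) : L (idx d) < L k := by
  obtain ⟨d', h1', h2', hk', hL⟩ := h.cover k (by omega) hkj
  have : d < d' := by
    by_contra hc
    rcases (not_lt.1 hc).eq_or_lt with rfl | hc
    · omega
    · have := h.idx_lt d' d h1' hc h2; omega
  exact (h.val_lt d d' h1 this h2').trans_le hL

lemma singleton (L : ℕ → ℤ) {idx : ℕ → ℕ} (h : idx 1 = 1) : IsMonoStack L 1 1 idx where
  one_le := le_rfl
  first := h
  last := h
  idx_lt := by intros; omega
  val_lt := by intros; omega
  cover := fun k h1 h2 => ⟨1, le_rfl, le_rfl, by omega, by rw [h, show k = 1 by omega]⟩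

/-- The entry below the top is the last index before `j` with a smaller value. -/
lemma prev_spec (h : IsMonoStack L j D idx) (hD : 2 ≤ D) :
    idx (D - 1) < j ∧ L (idx (D - 1)) < L j ∧ ∀ k, idx (D - 1) < k → k ≤ j → L j ≤ L k := by
  refine ⟨?_, ?_, fun k hk hkj => ?_⟩
  · rw [← h.last]; exact h.idx_lt _ _ (by omega) (by omega) le_rfl
  · conv_rhs => rw [← h.last]
    exact h.val_lt _ _ (by omega) (by omega) le_rfl
  · obtain ⟨d, h1, h2, hk', hL⟩ := h.cover k (by omega) hkj
    rcases h2.eq_or_lt with rfl | h2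
    · rwa [h.last] at hL
    · have : idx d ≤ idx (D - 1) := by
        rcases (show d ≤ D - 1 by omega).eq_or_lt with rfl | h3
        · exact le_rfl
        · exact (h.idx_lt _ _ h1 h3 (by omega)).le
      omega

/-- Popping the entries above level `D'`, all with values at least `L (j + 1)`, and pushing
`j + 1`. -/
lemma push (h : IsMonoStack L j D idx) {D' : ℕ} (h1 : 1 ≤ D') (h2 : D' ≤ D)
    (hlt : L (idx D') < L (j + 1))
    (hpop : ∀ d, D' < d → d ≤ D → L (j + 1) ≤ L (idx d)) :
    IsMonoStack L (j + 1) (D' + 1) (Function.update idx (D' + 1) (j + 1)) := by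
  have hold : ∀ d, d ≤ D' → Function.update idx (D' + 1) (j + 1) d = idx d := fun d hd =>
    Function.update_of_ne (by omega) _ _
  refine ⟨by omega, ?_, by simp, ?_, ?_, ?_⟩
  · rw [hold 1 h1, h.first]
  · intro d d' hd hdd hd'
    rw [hold d (by omega)]
    rcases hd'.eq_or_lt with rfl | hd'
    · have := h.idx_le hd (by omega); simp; omega
    · rw [hold d' (by omega)]; exact h.idx_lt d d' hd hdd (by omega)
  · intro d d' hd hdd hd'
    rw [hold d (by omega)]
    rcases hd'.eq_or_lt with rfl | hd'
    · simp only [Function.update_self]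
      rcases (show d ≤ D' by omega).eq_or_lt with rfl | h3
      · exact hlt
      · exact (h.val_lt d D' hd h3 h2).trans hlt
    · rw [hold d' (by omega)]; exact h.val_lt d d' hd hdd (by omega)
  · intro k hk hkj
    rcases hkj.eq_or_lt with rfl | hkj
    · exact ⟨D' + 1, by omega, le_rfl, by simp, by simp⟩
    · obtain ⟨d, hd1, hd2, hk', hL⟩ := h.cover k hk (by omega)
      by_cases hd : d ≤ D'
      · exact ⟨d, hd1, by omega, by rwa [hold d hd], by rwa [hold d hd]⟩
      · exact ⟨D' + 1, by omega, le_rfl, by simp; omega,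
          by simpa using (hpop d (by omega) hd2).trans hL⟩

end IsMonoStack

/-- What is known later, at time `j`, about the depth `d₀` that the stack had at time `i₀`: the
entries from level `d₀` on are at or after `i₀`, and, as long as no value below `L i₀` has
occurred, level `d₀` is still there and the entry below it is before `i₀`. -/
structure IsDepthMark (L : ℕ → ℤ) (j D : ℕ) (idx : ℕ → ℕ) (i₀ d₀ : ℕ) : Prop where
  two_le : 2 ≤ d₀
  le_now : i₀ ≤ j
  le_idx : ∀ d, d₀ ≤ d → d ≤ D → i₀ ≤ idx d
  of_open : (∀ m, i₀ < m → m ≤ j → L i₀ ≤ L m) → d₀ ≤ D ∧ idx (d₀ - 1) < i₀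

namespace IsDepthMark

variable {L : ℕ → ℤ} {j D i₀ d₀ : ℕ} {idx : ℕ → ℕ}

lemma of_top (h : IsMonoStack L j D idx) (hD : 2 ≤ D) : IsDepthMark L j D idx j D where
  two_le := hD
  le_now := le_rfl
  le_idx := fun d h1 h2 => by rw [le_antisymm h2 h1, h.last]
  of_open := fun _ => ⟨le_rfl, (h.prev_spec hD).1⟩

/-- As long as no value below `L i₀` occurs, the entries before `i₀` have smaller values than the
pushed index, so that they are not popped. -/
lemma push (hm : IsDepthMark L j D idx i₀ d₀) (h : IsMonoStack L j D idx) {D' : ℕ}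
    (h2 : D' ≤ D)
    (hpop : ∀ d, D' < d → d ≤ D → L (j + 1) ≤ L (idx d)) :
    IsDepthMark L (j + 1) (D' + 1) (Function.update idx (D' + 1) (j + 1)) i₀ d₀ := by
  have hold : ∀ d, d ≤ D' → Function.update idx (D' + 1) (j + 1) d = idx d := fun d hd =>
    Function.update_of_ne (by omega) _ _
  have h2' := hm.two_le
  refine ⟨hm.two_le, by have := hm.le_now; omega, fun d hd hdD => ?_, fun ho => ?_⟩
  · rcases hdD.eq_or_lt with rfl | hdD
    · have := hm.le_now; simp; omega
    · rw [hold d (by omega)]; exact hm.le_idx d hd (by omega)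
  · obtain ⟨h3, h4⟩ := hm.of_open fun m h3 h4 => ho m h3 (by omega)
    have h5 := h.val_lt_of_lt (d := d₀ - 1) (k := i₀) (by omega) (by omega) h4 hm.le_now
    have h6 := ho (j + 1) (by have := hm.le_now; omega) le_rfl
    have h7 : d₀ - 1 ≤ D' := by
      by_contra hc
      have := hpop (d₀ - 1) (by omega) (by omega)
      omega
    exact ⟨by omega, by rwa [hold _ h7]⟩

/-- The constant-time test of whether a value below `L i₀` has occurred since `i₀`. -/
lemma open_iff (hm : IsDepthMark L j D idx i₀ d₀) (h : IsMonoStack L j D idx) (hi : 1 ≤ i₀) :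
    (∀ m, i₀ < m → m ≤ j → L i₀ ≤ L m) ↔
      d₀ ≤ D ∧ idx (d₀ - 1) < i₀ ∧ L i₀ ≤ L (idx d₀) := by
  have h2' := hm.two_le
  constructor
  · intro ho
    obtain ⟨h1, h2⟩ := hm.of_open ho
    refine ⟨h1, h2, ?_⟩
    have h3 := hm.le_idx d₀ le_rfl h1
    rcases h3.eq_or_lt with h3 | h3
    · rw [← h3]
    · exact ho _ h3 (h.idx_le (by omega) h1)
  · rintro ⟨h1, h2, h3⟩ m hm1 hm2
    obtain ⟨d, hd1, hd2, hk, hL⟩ := h.cover m (by omega) hm2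
    have : d₀ ≤ d := by
      by_contra hc
      rcases (show d ≤ d₀ - 1 by omega).eq_or_lt with rfl | h4
      · omega
      · have := h.idx_lt d (d₀ - 1) hd1 h4 (by omega); omega
    rcases this.eq_or_lt with rfl | h4
    · exact h3.trans hL
    · exact h3.trans ((h.val_lt d₀ d (by omega) h4 hd2).le.trans hL)

end IsDepthMark

/-! ### Candidates -/

/-- `i` lies in the box of `j`: all values between `i` and `j` are at least `L j`. -/
def InBox (L : ℕ → ℤ) (j i : ℕ) : Prop :=
  ∀ k, (i < k ∧ k ≤ j) ∨ (j < k ∧ k ≤ i) → L j ≤ L k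

/-- A candidate: a character `char`, a boundary `event` of two runs, one of which consists of
this character, and the one of the indices `event - 1`, `event` in that run. -/
structure Candidate where
  char : ℕ
  event : ℕ
  pos : ℕ

/-- The candidates `1, …, N`, chosen up to time `j`, have pairwise disjoint boxes if they have the
same character (`sep`), and each of the events `E` processed so far has a candidate `k` such that
both `event - 1` and `event` of `k`, hence also its `pos`, lie in the box of that event
(`cover`). -/
structure IsCandidateList (B : ℕ → ℕ) (L : ℕ → ℤ) (j : ℕ) (E : ℕ → ℕ → Prop) (N : ℕ)
    (cand : ℕ → Candidate) : Prop where
  event_ge : ∀ k, 1 ≤ k → k ≤ N → 2 ≤ (cand k).event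
  event_le : ∀ k, 1 ≤ k → k ≤ N → (cand k).event ≤ j
  change : ∀ k, 1 ≤ k → k ≤ N → B ((cand k).event - 1) ≠ B (cand k).event
  pos_eq : ∀ k, 1 ≤ k → k ≤ N →
    (cand k).pos = (cand k).event ∨ (cand k).pos = (cand k).event - 1
  char_eq : ∀ k, 1 ≤ k → k ≤ N → B (cand k).pos = (cand k).char
  sep : ∀ k k', 1 ≤ k → k < k' → k' ≤ N → (cand k).char = (cand k').char →
    (∃ m, (cand k).event < m ∧ m < (cand k').event ∧ L m < L (cand k).event) ∧
    (∃ m, (cand k).event < m ∧ m < (cand k').event ∧ L m < L (cand k').event)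
  cover : ∀ i c, E i c → ∃ k, 1 ≤ k ∧ k ≤ N ∧ (cand k).char = c ∧
    ∀ m, ((cand k).event ≤ m ∧ m ≤ i) ∨ (i ≤ m ∧ m ≤ (cand k).event) → L i ≤ L m

/-- `k` is the last candidate with character `c`. -/
def IsLastCandidate (N : ℕ) (cand : ℕ → Candidate) (c k : ℕ) : Prop :=
  1 ≤ k ∧ k ≤ N ∧ (cand k).char = c ∧ ∀ k', 1 ≤ k' → k' ≤ N → (cand k').char = c → k' ≤ k

namespace IsCandidateList

variable {B : ℕ → ℕ} {L : ℕ → ℤ} {j N : ℕ} {E : ℕ → ℕ → Prop} {cand : ℕ → Candidate}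

lemma empty (B : ℕ → ℕ) (L : ℕ → ℤ) (j : ℕ) (cand : ℕ → Candidate) :
    IsCandidateList B L j (fun _ _ => False) 0 cand := by
  constructor <;> first | (intros; omega) | simp

lemma mono_time (h : IsCandidateList B L j E N cand) {j' : ℕ} (hj : j ≤ j') :
    IsCandidateList B L j' E N cand :=
  { h with event_le := fun k h1 h2 => (h.event_le k h1 h2).trans hj }

lemma congr_events (h : IsCandidateList B L j E N cand) {E' : ℕ → ℕ → Prop}
    (hE : ∀ i c, E' i c → E i c) : IsCandidateList B L j E' N cand :=
  { h with cover := fun i c hc => h.cover i c (hE i c hc) }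

/-- An event whose box contains an earlier candidate needs no candidate of its own. -/
lemma skip (h : IsCandidateList B L j E N cand) {c k : ℕ} (hk : IsLastCandidate N cand c k)
    (hge : ∀ m, (cand k).event ≤ m → m < j → L j ≤ L m) :
    IsCandidateList B L j (fun i c' => E i c' ∨ (i = j ∧ c' = c)) N cand := by
  refine { h with cover := ?_ }
  rintro i c' (hE | ⟨rfl, rfl⟩)
  · exact h.cover i c' hE
  · refine ⟨k, hk.1, hk.2.1, hk.2.2.1, ?_⟩
    have := h.event_le k hk.1 hk.2.1
    intro m hm
    rcases (show m ≤ i by omega).eq_or_lt with rfl | hm'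
    · exact le_rfl
    · exact hge m (by omega) hm'

/-- If the box of the last candidate with character `c` is closed and does not lie in the box of
`j`, the box of `j` is disjoint from the boxes of all candidates with this character. -/
lemma append (h : IsCandidateList B L j E N cand) {c p : ℕ} (hj : 2 ≤ j)
    (hch : B (j - 1) ≠ B j) (hp : p = j ∨ p = j - 1) (hB : B p = c)
    (hlast : (∀ k, 1 ≤ k → k ≤ N → (cand k).char ≠ c) ∨
      ∃ k, IsLastCandidate N cand c k ∧ (∃ m, (cand k).event ≤ m ∧ m < j ∧ L m < L j) ∧
        ∃ m, (cand k).event < m ∧ m ≤ j ∧ L m < L (cand k).event) :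
    IsCandidateList B L j (fun i c' => E i c' ∨ (i = j ∧ c' = c)) (N + 1)
      (Function.update cand (N + 1) ⟨c, j, p⟩) := by
  have hold : ∀ k, k ≤ N → Function.update cand (N + 1) ⟨c, j, p⟩ k = cand k := fun k hk =>
    Function.update_of_ne (by omega) _ _
  have key : ∀ k, 1 ≤ k → k ≤ N → (cand k).char = c →
      (∃ m, (cand k).event < m ∧ m < j ∧ L m < L (cand k).event) ∧
      (∃ m, (cand k).event < m ∧ m < j ∧ L m < L j) := by
    intro k hk1 hk2 hkc
    -- the separation from the last candidate passes on to the earlier ones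
    rcases hlast with hn | ⟨k₀, hk₀, ⟨a, ha1, ha2, ha3⟩, b, hb1, hb2, hb3⟩
    · exact absurd hkc (hn k hk1 hk2)
    have last : (∃ m, (cand k₀).event < m ∧ m < j ∧ L m < L (cand k₀).event) ∧
        (∃ m, (cand k₀).event < m ∧ m < j ∧ L m < L j) := by
      rcases ha1.eq_or_lt with rfl | ha1
      · have : b ≠ j := by rintro rfl; omega
        exact ⟨⟨b, hb1, by omega, hb3⟩, ⟨b, hb1, by omega, hb3.trans ha3⟩⟩
      · refine ⟨?_, a, ha1, ha2, ha3⟩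
        rcases hb2.eq_or_lt with rfl | hb2
        · exact ⟨a, ha1, ha2, ha3.trans hb3⟩
        · exact ⟨b, hb1, hb2, hb3⟩
    rcases (hk₀.2.2.2 k hk1 hk2 hkc).eq_or_lt with rfl | hlt
    · exact last
    · obtain ⟨⟨m, hm1, hm2, hm3⟩, -⟩ := h.sep k k₀ hk1 hlt hk₀.2.1 (hkc.trans hk₀.2.2.1.symm)
      obtain ⟨-, m', hm1', hm2', hm3'⟩ := last
      exact ⟨⟨m, hm1, by omega, hm3⟩, ⟨m', by omega, hm2', hm3'⟩⟩
  constructor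
  case cover =>
    rintro i c' (hE | ⟨rfl, rfl⟩)
    · obtain ⟨k, h1, h2, h3⟩ := h.cover i c' hE
      exact ⟨k, h1, by omega, by rwa [hold k h2]⟩
    · refine ⟨N + 1, by omega, le_rfl, by simp, ?_⟩
      intro m hm
      simp only [Function.update_self] at hm
      rw [show m = i by omega]
  case sep =>
    intro k k' h1 h2 h3
    rw [hold k (by omega)]
    rcases h3.eq_or_lt with rfl | h3
    · simp only [Function.update_self]
      exact fun hc => key k h1 (by omega) hc
    · rw [hold k' (by omega)]
      exact h.sep k k' h1 h2 (by omega)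
  all_goals
    intro k h1 h2
    rcases h2.eq_or_lt with rfl | h2
    · simp only [Function.update_self]
      first | exact hj | exact le_rfl | exact hch | exact hp | exact hB
    · rw [hold k (by omega)]
      first
        | exact h.event_ge k h1 (by omega) | exact h.event_le k h1 (by omega)
        | exact h.change k h1 (by omega) | exact h.pos_eq k h1 (by omega)
        | exact h.char_eq k h1 (by omega)

/-- If the box of the last candidate is still open and contains the smaller box of `j`, the
candidate moves to `j`. -/
lemma replace (h : IsCandidateList B L j E N cand) {c p k₀ : ℕ} (hj : 2 ≤ j)
    (hch : B (j - 1) ≠ B j) (hp : p = j ∨ p = j - 1) (hB : B p = c)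
    (hk : IsLastCandidate N cand c k₀) (hlt : ∃ m, (cand k₀).event ≤ m ∧ m < j ∧ L m < L j)
    (hopen : ∀ m, (cand k₀).event < m → m ≤ j → L (cand k₀).event ≤ L m) :
    IsCandidateList B L j (fun i c' => E i c' ∨ (i = j ∧ c' = c)) N
      (Function.update cand k₀ ⟨c, j, p⟩) := by
  have hold : ∀ k, k ≠ k₀ → Function.update cand k₀ ⟨c, j, p⟩ k = cand k := fun k hk =>
    Function.update_of_ne hk _ _
  obtain ⟨a, ha1, ha2, ha3⟩ := hlt
  have hopen' : ∀ m, (cand k₀).event ≤ m → m ≤ j → L (cand k₀).event ≤ L m := by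
    intro m h1 h2
    rcases h1.eq_or_lt with h1 | h1
    · rw [h1]
    · exact hopen m h1 h2
  have hL : L (cand k₀).event < L j := (hopen' a ha1 ha2.le).trans_lt ha3
  have hev := h.event_le k₀ hk.1 hk.2.1
  constructor
  case cover =>
    rintro i c' (hE | ⟨rfl, rfl⟩)
    · obtain ⟨k, h1, h2, h3, h4⟩ := h.cover i c' hE
      by_cases hkk : k = k₀
      -- an event covered by the old position has a value at most `L (event k₀)`, so that its box
      -- reaches up to `j`
      · subst hkk
        refine ⟨k, h1, h2, by simpa using hk.2.2.1.symm.trans h3, ?_⟩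
        intro m hm
        simp only [Function.update_self] at hm
        have h5 : L i ≤ L (cand k).event := h4 _ (by omega)
        by_cases h6 : (cand k).event ≤ m ∧ m ≤ j
        · exact h5.trans (hopen' m h6.1 h6.2)
        · exact h4 m (by omega)
      · exact ⟨k, h1, h2, by rwa [hold k hkk], by rwa [hold k hkk]⟩
    · refine ⟨k₀, hk.1, hk.2.1, by simp, ?_⟩
      intro m hm
      simp only [Function.update_self] at hm
      rw [show m = i by omega]
  case sep =>
    intro k k' h1 h2 h3 hc
    by_cases hkk : k = k₀
    · subst hkk
      rw [hold k' (by omega)] at hc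
      have := hk.2.2.2 k' (by omega) h3 (by simpa using hc.symm)
      omega
    rw [hold k hkk] at hc ⊢
    by_cases hkk' : k' = k₀
    · subst hkk'
      simp only [Function.update_self] at hc ⊢
      obtain ⟨⟨m, hm1, hm2, hm3⟩, m', hm1', hm2', hm3'⟩ :=
        h.sep k k' h1 h2 h3 (hc.trans hk.2.2.1.symm)
      exact ⟨⟨m, hm1, by omega, hm3⟩, ⟨m', hm1', by omega, hm3'.trans hL⟩⟩
    · rw [hold k' hkk'] at hc ⊢
      exact h.sep k k' h1 h2 h3 hc
  all_goals
    intro k h1 h2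
    by_cases hkk : k = k₀
    · subst hkk
      simp only [Function.update_self]
      first | exact hj | exact le_rfl | exact hch | exact hp | exact hB
    · rw [hold k hkk]
      first
        | exact h.event_ge k h1 (by omega) | exact h.event_le k h1 (by omega)
        | exact h.change k h1 (by omega) | exact h.pos_eq k h1 (by omega)
        | exact h.char_eq k h1 (by omega)

/-- The boxes of two candidates with the same character are disjoint. -/
lemma disjoint (h : IsCandidateList B L j E N cand) {k k' i : ℕ} (h1 : 1 ≤ k) (h2 : k < k')
    (h3 : k' ≤ N) (hc : (cand k).char = (cand k').char) (hi : InBox L (cand k).event i)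
    (hi' : InBox L (cand k').event i) : False := by
  obtain ⟨⟨a, ha1, ha2, ha3⟩, b, hb1, hb2, hb3⟩ := h.sep k k' h1 h2 h3 hc
  -- `L (event k') > L b ≥ L (event k) > L a ≥ L (event k')`
  have h4 : i < a := by
    by_contra h4
    have := hi a (Or.inr ⟨ha1, by omega⟩)
    omega
  have h5 : b ≤ i := by
    by_contra h5
    have := hi' b (Or.inl ⟨by omega, by omega⟩)
    omega
  have h6 := hi b (Or.inr ⟨hb1, by omega⟩)
  have h7 := hi' a (Or.inl ⟨h4, by omega⟩)
  omega

lemma pos_lt (h : IsCandidateList B L j E N cand) {k k' : ℕ} (h1 : 1 ≤ k) (h2 : k < k')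
    (h3 : k' ≤ N) (hc : (cand k).char = (cand k').char) : (cand k).pos < (cand k').pos := by
  obtain ⟨⟨a, ha1, ha2, ha3⟩, -⟩ := h.sep k k' h1 h2 h3 hc
  have := h.pos_eq k h1 (by omega)
  have := h.pos_eq k' (by omega) h3
  omega

lemma pos_mem (h : IsCandidateList B L j E N cand) {k : ℕ} (h1 : 1 ≤ k) (h2 : k ≤ N) :
    1 ≤ (cand k).pos ∧ (cand k).pos ≤ j := by
  have := h.event_ge k h1 h2
  have := h.event_le k h1 h2
  have := h.pos_eq k h1 h2
  omega

/-- Every set of indices that hits, for each candidate, the box of its event in an index with the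
candidate's character has at least `N` elements. -/
lemma card_le (h : IsCandidateList B L j E N cand) {Y : Finset ℕ}
    (hY : ∀ k, 1 ≤ k → k ≤ N → ∃ i ∈ Y, B i = (cand k).char ∧ InBox L (cand k).event i) :
    N ≤ Y.card := by
  have hY' : ∀ k ∈ Finset.Icc 1 N,
      ∃ i ∈ Y, B i = (cand k).char ∧ InBox L (cand k).event i := fun k hk =>
    hY k (Finset.mem_Icc.1 hk).1 (Finset.mem_Icc.1 hk).2
  choose! f hf hB hbox using hY'
  have hinj : Set.InjOn f (Finset.Icc 1 N : Finset ℕ) := by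
    intro a ha b hb hab
    have ha' := Finset.mem_Icc.1 ha
    have hb' := Finset.mem_Icc.1 hb
    have hc : (cand a).char = (cand b).char := by rw [← hB a ha, ← hB b hb, hab]
    rcases lt_trichotomy a b with hlt | rfl | hlt
    · exact (h.disjoint ha'.1 hlt hb'.2 hc (hbox a ha) (hab ▸ hbox b hb)).elim
    · rfl
    · exact (h.disjoint hb'.1 hlt ha'.2 hc.symm (hbox b hb) (hab ▸ hbox a ha)).elim
  simpa using Finset.card_le_card_of_injOn f hf hinj

end IsCandidateList

/-! ### Longest common prefixes and the lexicographic order -/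

lemma prefix_iff_le_lcpLength {v a : List ℕ} (b : List ℕ) (h : v <+: a) :
    v <+: b ↔ v.length ≤ lcpLength a b := by
  induction v generalizing a b with
  | nil => simp
  | cons x v ih =>
    cases a with
    | nil => simp at h
    | cons y a =>
      rw [List.cons_prefix_cons] at h
      obtain ⟨rfl, h⟩ := h
      cases b with
      | nil => simp [lcpLength]
      | cons z b =>
        rw [List.cons_prefix_cons, lcpLength]
        split_ifs with hxz
        · simp [hxz, ih b h]
        · simp [hxz]

lemma lcpLength_le_left (a b : List ℕ) : lcpLength a b ≤ a.length := by
  induction a generalizing b with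
  | nil => simp [lcpLength]
  | cons x a ih =>
    cases b with
    | nil => simp [lcpLength]
    | cons y b =>
      rw [lcpLength]
      split_ifs
      · simpa using ih b
      · simp

/-- The strings with a given prefix are convex in the lexicographic order. -/
lemma prefix_of_lt_of_lt {v a b c : List ℕ} (ha : v <+: a) (hc : v <+: c) (hab : a < b)
    (hbc : b < c) : v <+: b := by
  induction v generalizing a b c with
  | nil => simp
  | cons x v ih =>
    cases a with
    | nil => simp at ha
    | cons y a =>
      cases c with
      | nil => simp at hc
      | cons z c =>
        cases b with
        | nil => simp at hab
        | cons t b =>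
          rw [List.cons_prefix_cons] at ha hc ⊢
          rw [List.cons_lt_cons_iff] at hab hbc
          obtain ⟨rfl, ha⟩ := ha
          obtain ⟨rfl, hc⟩ := hc
          rcases hab with h1 | ⟨rfl, h1⟩
          · omega
          · rcases hbc with h2 | ⟨-, h2⟩
            · omega
            · exact ⟨rfl, ih ha hc h1 h2⟩

/-- A final sentinel does not influence the order of strings without sentinels. -/
lemma lt_of_append_sentinel_lt {a b : List ℕ} (ha : ∀ x ∈ a, sentinel < x)
    (h : a ++ [sentinel] < b ++ [sentinel]) : a < b := by
  induction a generalizing b with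
  | nil =>
    cases b with
    | nil => simp at h
    | cons y b => simp
  | cons x a ih =>
    cases b with
    | nil =>
      have hx := ha x (by simp)
      simp only [List.cons_append, List.nil_append, List.cons_lt_cons_iff] at h
      simp only [sentinel] at *
      rcases h with h | ⟨h, -⟩ <;> omega
    | cons y b =>
      simp only [List.cons_append, List.cons_lt_cons_iff] at h ⊢
      exact h.imp id fun h => ⟨h.1, ih (fun z hz => ha z (by simp [hz])) h.2⟩

/-- Terminated by sentinels, two distinct strings differ right after their longest common
prefix. -/
lemma exists_branch {v a b : List ℕ} (ha : v <+: a) (hb : v <+: b)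
    (hv : v.length = lcpLength a b) (hab : a ≠ b) (ha' : sentinel ∉ a) (hb' : sentinel ∉ b) :
    ∃ x y, x ≠ y ∧ v ++ [x] <+: a ++ [sentinel] ∧ v ++ [y] <+: b ++ [sentinel] := by
  induction v generalizing a b with
  | nil =>
    cases a with
    | nil =>
      cases b with
      | nil => simp at hab
      | cons y b => exact ⟨sentinel, y, by aesop, by simp, by simp⟩
    | cons x a =>
      cases b with
      | nil => exact ⟨x, sentinel, by aesop, by simp, by simp⟩
      | cons y b =>
        refine ⟨x, y, ?_, by simp, by simp⟩
        rintro rfl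
        simp [lcpLength] at hv
  | cons z v ih =>
    cases a with
    | nil => simp at ha
    | cons x a =>
      cases b with
      | nil => simp at hb
      | cons y b =>
        rw [List.cons_prefix_cons] at ha hb
        obtain ⟨rfl, ha⟩ := ha
        obtain ⟨rfl, hb⟩ := hb
        obtain ⟨x, y, h1, h2, h3⟩ := ih ha hb (by simpa [lcpLength] using hv) (by simpa using hab)
          (by simp_all) (by simp_all)
        exact ⟨x, y, h1, by simpa using h2, by simpa using h3⟩

/-! ### The suffix array of the reversed text -/

/-- The reverse of the prefix `T[1..n - SA[i]]`: the `i`-th suffix of the reversed text without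
its final sentinel. -/
def revPrefix (T : List ℕ) (SA : ℕ → ℕ) (i : ℕ) : List ℕ := (T.take (T.length - SA i)).reverse

section
variable {σ : ℕ} {T : List ℕ} {SA : ℕ → ℕ}

lemma IsText.two_le_length (hT : IsText σ T) : 2 ≤ T.length := by
  obtain ⟨h2, hc, -⟩ := hT
  have h1 : (1 : ℕ) ∈ T := (hc 1).2 (by omega)
  have h2 : (2 : ℕ) ∈ T := (hc 2).2 (by omega)
  match T, h1, h2 with
  | [a], h1, h2 =>
    exact absurd ((List.mem_singleton.1 h1).trans (List.mem_singleton.1 h2).symm) (by omega)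
  | _ :: _ :: _, _, _ => simp

lemma length_revText (hT : IsText σ T) : (revText T).length = T.length := by
  have := hT.two_le_length
  simp [revText]
  omega

lemma sa_mem (hT : IsText σ T) (hSA : IsSuffixArray (revText T) SA) {i : ℕ} (h1 : 1 ≤ i)
    (h2 : i ≤ T.length) : 1 ≤ SA i ∧ SA i ≤ T.length := by
  have := hSA.1.mapsTo (show i ∈ Set.Icc 1 (revText T).length by
    rw [length_revText hT]; exact ⟨h1, h2⟩)
  rwa [length_revText hT] at this

lemma exists_sa_eq (hT : IsText σ T) (hSA : IsSuffixArray (revText T) SA) {k : ℕ} (h1 : 1 ≤ k)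
    (h2 : k ≤ T.length) : ∃ i, 1 ≤ i ∧ i ≤ T.length ∧ SA i = k := by
  obtain ⟨i, hi, rfl⟩ := hSA.1.surjOn (show k ∈ Set.Icc 1 (revText T).length by
    rw [length_revText hT]; exact ⟨h1, h2⟩)
  rw [length_revText hT] at hi
  exact ⟨i, hi.1, hi.2, rfl⟩

lemma drop_revText (hT : IsText σ T) (hSA : IsSuffixArray (revText T) SA) {i : ℕ} (h1 : 1 ≤ i)
    (h2 : i ≤ T.length) : (revText T).drop (SA i - 1) = revPrefix T SA i ++ [sentinel] := by
  obtain ⟨h3, h4⟩ := sa_mem hT hSA h1 h2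
  obtain ⟨-, -, U, rfl, -⟩ := hT
  simp only [List.length_append, List.length_singleton] at h4
  rw [revText, revPrefix, List.drop_append_of_le_length (by simp; omega)]
  simp only [List.dropLast_concat, List.length_append, List.length_singleton]
  rw [List.take_append_of_le_length (by omega), List.drop_reverse,
    show U.length - (SA i - 1) = U.length + 1 - SA i by omega]

lemma revPrefix_suffix (hT : IsText σ T) (hSA : IsSuffixArray (revText T) SA) {i : ℕ}
    (h1 : 1 ≤ i) (h2 : i ≤ T.length) : revPrefix T SA i ++ [sentinel] <:+ revText T := by
  rw [← drop_revText hT hSA h1 h2]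
  exact List.drop_suffix _ _

lemma sentinel_lt_of_mem_revPrefix (hT : IsText σ T) (hSA : IsSuffixArray (revText T) SA)
    {i : ℕ} (h1 : 1 ≤ i) (h2 : i ≤ T.length) : ∀ x ∈ revPrefix T SA i, sentinel < x := by
  obtain ⟨h3, h4⟩ := sa_mem hT hSA h1 h2
  obtain ⟨-, hc, U, rfl, hU⟩ := hT
  intro x hx
  simp only [List.length_append, List.length_singleton] at h4
  rw [revPrefix, List.mem_reverse, List.take_append_of_le_length (by simp; omega)] at hx
  have hxU := List.mem_of_mem_take hx
  have := ((hc x).1 (by simp [hxU])).1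
  rcases this.eq_or_lt with rfl | h
  · exact absurd hxU hU
  · exact h

lemma sentinel_notMem_revPrefix (hT : IsText σ T) (hSA : IsSuffixArray (revText T) SA)
    {i : ℕ} (h1 : 1 ≤ i) (h2 : i ≤ T.length) : sentinel ∉ revPrefix T SA i := fun h =>
  lt_irrefl _ (sentinel_lt_of_mem_revPrefix hT hSA h1 h2 _ h)

lemma revPrefix_append_lt (hT : IsText σ T) (hSA : IsSuffixArray (revText T) SA) {i j : ℕ}
    (h1 : 1 ≤ i) (hij : i < j) (h2 : j ≤ T.length) :
    revPrefix T SA i ++ [sentinel] < revPrefix T SA j ++ [sentinel] := by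
  rw [← drop_revText hT hSA h1 (by omega), ← drop_revText hT hSA (by omega) h2]
  exact hSA.2 i j h1 hij (by rwa [length_revText hT])

lemma revPrefix_lt (hT : IsText σ T) (hSA : IsSuffixArray (revText T) SA) {i j : ℕ}
    (h1 : 1 ≤ i) (hij : i < j) (h2 : j ≤ T.length) : revPrefix T SA i < revPrefix T SA j :=
  lt_of_append_sentinel_lt (sentinel_lt_of_mem_revPrefix hT hSA h1 (by omega))
    (revPrefix_append_lt hT hSA h1 hij h2)

lemma prefix_revPrefix_of_between (hT : IsText σ T) (hSA : IsSuffixArray (revText T) SA)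
    {i j k : ℕ} {v : List ℕ} (h1 : 1 ≤ i) (hij : i ≤ j) (hjk : j ≤ k) (h2 : k ≤ T.length)
    (hi : v <+: revPrefix T SA i) (hk : v <+: revPrefix T SA k) : v <+: revPrefix T SA j := by
  rcases hij.eq_or_lt with rfl | hij
  · exact hi
  rcases hjk.eq_or_lt with rfl | hjk
  · exact hk
  exact prefix_of_lt_of_lt hi hk (revPrefix_lt hT hSA h1 hij (by omega))
    (revPrefix_lt hT hSA (by omega) hjk h2)

lemma lcp_eq {i : ℕ} (hi : i ≠ 1) :
    lcp T SA i = (lcpLength (revPrefix T SA i) (revPrefix T SA (i - 1)) : ℤ) := by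
  rw [lcp, if_neg hi]; rfl

lemma lcp_one : lcp T SA 1 = -1 := by rw [lcp, if_pos rfl]

lemma lcp_nonneg {i : ℕ} (hi : i ≠ 1) : 0 ≤ lcp T SA i := by rw [lcp_eq hi]; positivity

lemma length_revPrefix_le (i : ℕ) : (revPrefix T SA i).length ≤ T.length := by
  simp [revPrefix]

lemma lcp_le (i : ℕ) : lcp T SA i ≤ T.length := by
  by_cases hi : i = 1
  · rw [hi, lcp_one]; omega
  · rw [lcp_eq hi]
    exact_mod_cast (lcpLength_le_left _ _).trans (length_revPrefix_le i)

lemma abs_lcp_le (hT : IsText σ T) (i : ℕ) : |lcp T SA i| ≤ T.length := by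
  have := hT.two_le_length
  by_cases hi : i = 1
  · rw [hi, lcp_one]; simp; omega
  · rw [abs_of_nonneg (lcp_nonneg hi)]; exact lcp_le i

/-- A common prefix of two of the sorted strings is bounded by the `LCP` values between them. -/
lemma le_lcp_of_prefix (hT : IsText σ T) (hSA : IsSuffixArray (revText T) SA) {i j k : ℕ}
    {v : List ℕ} (h1 : 1 ≤ i) (h2 : j ≤ T.length) (hi : v <+: revPrefix T SA i)
    (hj : v <+: revPrefix T SA j) (hik : i < k) (hkj : k ≤ j) : (v.length : ℤ) ≤ lcp T SA k := by
  rw [lcp_eq (by omega)]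
  have h3 := prefix_revPrefix_of_between hT hSA h1 hik.le hkj h2 hi hj
  have h4 := prefix_revPrefix_of_between hT hSA h1 (show i ≤ k - 1 by omega) (by omega) h2 hi hj
  exact_mod_cast (prefix_iff_le_lcpLength _ h3).1 h4

lemma prefix_of_le_lcp {i j : ℕ} {v : List ℕ} (h1 : 1 ≤ i) (hij : i ≤ j)
    (h : ∀ k, i < k → k ≤ j → (v.length : ℤ) ≤ lcp T SA k) (hj : v <+: revPrefix T SA j) :
    v <+: revPrefix T SA i := by
  induction hij using Nat.decreasingInduction with
  | self => exact hj
  | of_succ k hk ih =>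
    have h3 := ih (by omega) fun m hm => h m (by omega)
    have h4 := h (k + 1) (by omega) (by omega)
    rw [lcp_eq (by omega), Nat.cast_le] at h4
    simpa using (prefix_iff_le_lcpLength _ h3).2 h4

lemma lcpLength_comm (a b : List ℕ) : lcpLength a b = lcpLength b a := by
  induction a generalizing b with
  | nil => cases b <;> simp [lcpLength]
  | cons x a ih =>
    cases b with
    | nil => simp [lcpLength]
    | cons y b => simp [lcpLength, ih b, eq_comm]

lemma prefix_of_le_lcp' {i j : ℕ} {v : List ℕ} (h1 : 1 ≤ i) (hij : i ≤ j)
    (h : ∀ k, i < k → k ≤ j → (v.length : ℤ) ≤ lcp T SA k) (hi : v <+: revPrefix T SA i) :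
    v <+: revPrefix T SA j := by
  induction hij with
  | refl => exact hi
  | @step k hk ih =>
    have hk : i ≤ k := hk
    have h3 := ih fun m hm hm' => h m hm (by omega)
    have h4 := h (k + 1) (by omega) (by omega)
    rw [lcp_eq (by omega), Nat.cast_le, lcpLength_comm] at h4
    exact (prefix_iff_le_lcpLength _ (by simpa using h3)).2 h4

/-- The common prefix of length `LCP[j]` of the strings `j - 1` and `j`. -/
lemma exists_prefix_length_eq_lcp {j : ℕ} (hj : 2 ≤ j) :
    ∃ v : List ℕ, (v.length : ℤ) = lcp T SA j ∧ v <+: revPrefix T SA j := by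
  refine ⟨(revPrefix T SA j).take (lcpLength (revPrefix T SA j) (revPrefix T SA (j - 1))), ?_,
    List.take_prefix _ _⟩
  rw [lcp_eq (by omega), List.length_take, min_eq_left (lcpLength_le_left _ _)]

/-- The box of `j` is the set of the strings that start with the common prefix of the strings
`j - 1` and `j`. -/
lemma inBox_iff (hT : IsText σ T) (hSA : IsSuffixArray (revText T) SA) {i j : ℕ} {v : List ℕ}
    (hj1 : 1 ≤ j) (hj2 : j ≤ T.length) (hi1 : 1 ≤ i) (hi2 : i ≤ T.length)
    (hv : (v.length : ℤ) = lcp T SA j) (hvj : v <+: revPrefix T SA j) :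
    InBox (lcp T SA) j i ↔ v <+: revPrefix T SA i := by
  constructor
  · intro h
    rcases le_total i j with hij | hij
    · exact prefix_of_le_lcp hi1 hij (fun k h3 h4 => hv ▸ h k (Or.inl ⟨h3, h4⟩)) hvj
    · exact prefix_of_le_lcp' hj1 hij (fun k h3 h4 => hv ▸ h k (Or.inr ⟨h3, h4⟩)) hvj
  · rintro h k (⟨h3, h4⟩ | ⟨h3, h4⟩)
    · exact hv ▸ le_lcp_of_prefix hT hSA hi1 hj2 h hvj h3 h4
    · exact hv ▸ le_lcp_of_prefix hT hSA hj1 hi2 hvj h h3 h4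

/-- `BWT[i]` is the character of `T` that follows the prefix `T[1..n - SA[i]]`. -/
lemma take_succ_eq (hT : IsText σ T) (hSA : IsSuffixArray (revText T) SA) {i : ℕ} (h1 : 1 ≤ i)
    (h2 : i ≤ T.length) :
    (T.take (T.length + 1 - SA i)).reverse = bwt T SA i :: revPrefix T SA i := by
  obtain ⟨h3, h4⟩ := sa_mem hT hSA h1 h2
  have h5 : T.length - SA i < T.length := by omega
  have h6 : bwt T SA i = T[T.length - SA i] := by
    obtain ⟨-, -, U, rfl, -⟩ := hT
    rw [bwt, revText]
    split_ifs with h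
    · simp [h]
    · simp only [List.length_append, List.length_singleton] at h4 h5 ⊢
      rw [List.getD_append _ _ _ _ (by simp; omega), List.getD_eq_getElem _ _ (by simp; omega)]
      simp only [List.dropLast_concat, List.getElem_reverse]
      rw [List.getElem_append_left (by omega)]
      congr 1
      omega
  rw [show T.length + 1 - SA i = T.length - SA i + 1 by omega, List.take_succ_eq_append_getElem h5,
    List.reverse_append, revPrefix, h6]
  rfl

lemma bwt_mem (hT : IsText σ T) (hSA : IsSuffixArray (revText T) SA) {i : ℕ} (h1 : 1 ≤ i)
    (h2 : i ≤ T.length) : 1 ≤ bwt T SA i ∧ bwt T SA i ≤ σ := by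
  rw [← hT.2.1]
  have : bwt T SA i ∈ (T.take (T.length + 1 - SA i)).reverse := by
    rw [take_succ_eq hT hSA h1 h2]; simp
  exact List.mem_of_mem_take (List.mem_reverse.1 this)

lemma suffix_take_iff (hT : IsText σ T) (hSA : IsSuffixArray (revText T) SA) {i c : ℕ}
    {u : List ℕ} (h1 : 1 ≤ i) (h2 : i ≤ T.length) :
    u ++ [c] <:+ T.take (T.length + 1 - SA i) ↔
      u.reverse <+: revPrefix T SA i ∧ bwt T SA i = c := by
  rw [← List.reverse_prefix, take_succ_eq hT hSA h1 h2]
  simp only [List.reverse_append, List.reverse_cons, List.reverse_nil, List.nil_append,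
    List.cons_append, List.cons_prefix_cons]
  tauto

lemma infix_iff (hT : IsText σ T) (hSA : IsSuffixArray (revText T) SA) {c : ℕ} {u : List ℕ} :
    u ++ [c] <:+: T ↔
      ∃ i, 1 ≤ i ∧ i ≤ T.length ∧ u.reverse <+: revPrefix T SA i ∧ bwt T SA i = c := by
  constructor
  · rintro ⟨s, t, h⟩
    have hlen : (s ++ (u ++ [c])).length ≤ T.length := by rw [← h]; simp
    have htake : T.take (s ++ (u ++ [c])).length = s ++ (u ++ [c]) := by
      rw [← h, List.take_left]
    have hpos : 1 ≤ (s ++ (u ++ [c])).length := by simp; omega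
    obtain ⟨i, h1, h2, h3⟩ := exists_sa_eq hT hSA
      (k := T.length + 1 - (s ++ (u ++ [c])).length) (by omega) (by omega)
    refine ⟨i, h1, h2, (suffix_take_iff hT hSA h1 h2).1 ?_⟩
    rw [h3, show T.length + 1 - (T.length + 1 - (s ++ (u ++ [c])).length)
      = (s ++ (u ++ [c])).length by omega, htake]
    exact List.suffix_append _ _
  · rintro ⟨i, h1, h2, h3⟩
    exact ((suffix_take_iff hT hSA h1 h2).2 h3).isInfix.trans (List.take_prefix _ _).isInfix

/-! ### Suffixient sets and boxes -/

/-- The character `c` occurs at the boundary `j` between two runs of `BWT`. -/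
def IsEvent (T : List ℕ) (SA : ℕ → ℕ) (j c : ℕ) : Prop :=
  2 ≤ j ∧ j ≤ T.length ∧ bwt T SA (j - 1) ≠ bwt T SA j ∧ (c = bwt T SA (j - 1) ∨ c = bwt T SA j)

lemma IsSuffixient.exists_inBox (hT : IsText σ T) (hSA : IsSuffixArray (revText T) SA)
    {X : Finset ℕ} (hX : IsSuffixient T X) {j c : ℕ} (hE : IsEvent T SA j c) :
    ∃ i, 1 ≤ i ∧ i ≤ T.length ∧ T.length + 1 - SA i ∈ X ∧ bwt T SA i = c ∧
      InBox (lcp T SA) j i := by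
  obtain ⟨hj1, hj2, hne, hc⟩ := hE
  obtain ⟨v, hv, hvj⟩ := exists_prefix_length_eq_lcp (T := T) (SA := SA) hj1
  have hvj' : v <+: revPrefix T SA (j - 1) :=
    (inBox_iff hT hSA (by omega) hj2 (by omega) (by omega) hv hvj).1 fun k hk => by
      rw [show k = j by omega]
  have hinf : ∀ c, (c = bwt T SA (j - 1) ∨ c = bwt T SA j) → v.reverse ++ [c] <:+: T := by
    rintro c (rfl | rfl)
    · exact (infix_iff hT hSA).2 ⟨j - 1, by omega, by omega, by simpa using hvj', rfl⟩
    · exact (infix_iff hT hSA).2 ⟨j, by omega, by omega, by simpa using hvj, rfl⟩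
  obtain ⟨x, hx, hsuf⟩ := hX.2 v.reverse c
    ⟨_, _, hne, hinf _ (Or.inl rfl), hinf _ (Or.inr rfl)⟩ (hinf c hc)
  have hx' := Finset.mem_Icc.1 (hX.1 hx)
  obtain ⟨i, h1, h2, h3⟩ := exists_sa_eq hT hSA (k := T.length + 1 - x) (by omega) (by omega)
  have h4 : T.length + 1 - SA i = x := by omega
  rw [← h4, suffix_take_iff hT hSA h1 h2] at hsuf
  refine ⟨i, h1, h2, h4 ▸ hx, hsuf.2, ?_⟩
  exact (inBox_iff hT hSA (by omega) hj2 h1 h2 hv hvj).2 (by simpa using hsuf.1)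

/-- Between two indices with different values there is a change that involves the value of the
first one. -/
lemma exists_change {B : ℕ → ℕ} {a b : ℕ} (hab : a < b) (h : B a ≠ B b) :
    (∃ j, a < j ∧ j ≤ b ∧ B (j - 1) = B a ∧ B (j - 1) ≠ B j) ∧
      ∃ j, a < j ∧ j ≤ b ∧ B j = B b ∧ B (j - 1) ≠ B j := by
  induction b, hab using Nat.le_induction with
  | base => exact ⟨⟨a + 1, by simpa using h⟩, ⟨a + 1, by simpa using h⟩⟩
  | succ b hb ih =>
    by_cases h1 : B b = B (b + 1)
    · obtain ⟨⟨j, hj⟩, j', hj'⟩ := ih (by rwa [h1])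
      exact ⟨⟨j, by omega⟩, ⟨j', by rw [← h1]; omega⟩⟩
    · refine ⟨?_, b + 1, by omega, le_rfl, rfl, h1⟩
      by_cases h2 : B a = B b
      · exact ⟨b + 1, by omega, le_rfl, h2.symm, h1⟩
      · obtain ⟨⟨j, hj⟩, -⟩ := ih h2
        exact ⟨j, by omega⟩

/-- The indices whose strings start with the reverse of a right-maximal `u` form an interval on
which `BWT` is not constant; it contains an event of each character that occurs on it, together
with the box of that event. -/
lemma isSuffixient_of_inBox (hT : IsText σ T) (hSA : IsSuffixArray (revText T) SA)
    {X : Finset ℕ} (hX : X ⊆ Finset.Icc 1 T.length)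
    (h : ∀ j c, IsEvent T SA j c → ∃ i, 1 ≤ i ∧ i ≤ T.length ∧ T.length + 1 - SA i ∈ X ∧
      bwt T SA i = c ∧ InBox (lcp T SA) j i) : IsSuffixient T X := by
  refine ⟨hX, fun u c hu huc => ?_⟩
  obtain ⟨i, hi1, hi2, hi3, hi4⟩ := (infix_iff hT hSA).1 huc
  obtain ⟨i', hi1', hi2', hi3', hi4'⟩ : ∃ i', 1 ≤ i' ∧ i' ≤ T.length ∧
      u.reverse <+: revPrefix T SA i' ∧ bwt T SA i' ≠ c := by
    obtain ⟨a, b, hab, ha, hb⟩ := hu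
    by_cases hac : a = c
    · obtain ⟨k, h1, h2, h3, h4⟩ := (infix_iff hT hSA).1 hb
      exact ⟨k, h1, h2, h3, by rintro h5; exact hab (by rw [hac, ← h5, h4])⟩
    · obtain ⟨k, h1, h2, h3, h4⟩ := (infix_iff hT hSA).1 ha
      exact ⟨k, h1, h2, h3, by rwa [h4]⟩
  obtain ⟨j, a, b, ha1, hb2, ha, hb, haj, hjb, hE⟩ : ∃ j a b, 1 ≤ a ∧ b ≤ T.length ∧
      u.reverse <+: revPrefix T SA a ∧ u.reverse <+: revPrefix T SA b ∧ a < j ∧ j ≤ b ∧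
      IsEvent T SA j c := by
    rcases lt_trichotomy i i' with hlt | rfl | hlt
    · obtain ⟨⟨j, h1, h2, h3, h4⟩, -⟩ := exists_change (B := bwt T SA) hlt (by rw [hi4]; tauto)
      exact ⟨j, i, i', hi1, hi2', hi3, hi3', h1, h2, by omega, by omega, h4, by rw [h3, hi4]; simp⟩
    · exact absurd hi4 hi4'
    · obtain ⟨-, j, h1, h2, h3, h4⟩ := exists_change (B := bwt T SA) hlt (by rw [hi4]; tauto)
      exact ⟨j, i', i, hi1', hi2, hi3', hi3, h1, h2, by omega, by omega, h4, by rw [h3, hi4]; simp⟩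
  obtain ⟨k, hk1, hk2, hk3, hk4, hk5⟩ := h j c hE
  refine ⟨_, hk3, (suffix_take_iff hT hSA hk1 hk2).2 ⟨?_, hk4⟩⟩
  have hlen := le_lcp_of_prefix hT hSA ha1 hb2 ha hb haj hjb
  have hj := prefix_revPrefix_of_between hT hSA ha1 haj.le hjb hb2 ha hb
  rcases le_total k j with hkj | hkj
  · exact prefix_of_le_lcp hk1 hkj (fun m h3 h4 => hlen.trans (hk5 m (Or.inl ⟨h3, h4⟩))) hj
  · exact prefix_of_le_lcp' (by omega) hkj
      (fun m h3 h4 => hlen.trans (hk5 m (Or.inr ⟨h3, h4⟩))) hj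

/-- The empty string is right-maximal, so that every character needs an element of its own. -/
lemma IsSuffixient.alphabet_le_card (hT : IsText σ T) {X : Finset ℕ} (hX : IsSuffixient T X) :
    σ ≤ X.card := by
  have hinf : ∀ c, 1 ≤ c → c ≤ σ → [] ++ [c] <:+: T := fun c h1 h2 => by
    obtain ⟨s, t, h⟩ := List.append_of_mem ((hT.2.1 c).2 ⟨h1, h2⟩)
    exact ⟨s, t, by simp [h]⟩
  have h2 := hT.1
  have hmax : RightMaximal T [] := ⟨1, 2, by omega, hinf 1 le_rfl (by omega), hinf 2 (by omega) h2⟩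
  have : ∀ c ∈ Finset.Icc 1 σ, ∃ x ∈ X, [] ++ [c] <:+ T.take x := fun c hc =>
    hX.2 [] c hmax (hinf c (Finset.mem_Icc.1 hc).1 (Finset.mem_Icc.1 hc).2)
  choose! f hf hsuf using this
  have hinj : Set.InjOn f (Finset.Icc 1 σ : Finset ℕ) := by
    intro a ha b hb hab
    obtain ⟨s, hs⟩ := hsuf a ha
    obtain ⟨t, ht⟩ := hsuf b hb
    rw [← hab, ← hs] at ht
    simpa using (List.append_inj_right' ht rfl).symm
  simpa using Finset.card_le_card_of_injOn f hf hinj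

/-! ### The stack and the suffix tree -/

/-- A suffix that ends with the only sentinel cannot be extended. -/
lemma isLeaf_revPrefix (hT : IsText σ T) (hSA : IsSuffixArray (revText T) SA) {j : ℕ}
    (h1 : 1 ≤ j) (h2 : j ≤ T.length) : IsLeaf (revText T) (revPrefix T SA j ++ [sentinel]) := by
  refine ⟨⟨_, revPrefix_suffix hT hSA h1 h2, List.prefix_rfl⟩, ?_⟩
  rintro a ⟨v, ⟨s, hs⟩, t, rfl⟩
  obtain ⟨-, -, U, rfl, hU⟩ := hT
  have h3 : s ++ revPrefix (U ++ [sentinel]) SA j ++ [sentinel] ++ (a :: t) =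
      revText (U ++ [sentinel]) := by simpa using hs
  replace h3 := congrArg List.dropLast h3
  rw [revText, List.dropLast_concat, List.dropLast_concat,
    List.dropLast_append_of_ne_nil (by simp)] at h3
  have : sentinel ∈ U.reverse := by rw [← h3]; simp
  exact hU (List.mem_reverse.1 this)

lemma finite_branching_prefixes (S v : List ℕ) :
    {u | u <+: v ∧ IsBranchingNode S u}.Finite :=
  (List.finite_toSet v.inits).subset fun u hu => by simpa using hu.1

lemma length_mem_upperBounds_branching_depths (S : List ℕ) :
    S.length + 1 ∈
      upperBounds {k | ∃ v, IsLeaf S v ∧ k = Set.ncard {u | u <+: v ∧ IsBranchingNode S u}} := by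
  rintro k ⟨v, ⟨⟨w, hw, hv⟩, -⟩, rfl⟩
  calc Set.ncard {u | u <+: v ∧ IsBranchingNode S u}
      ≤ ((v.inits.toFinset : Finset (List ℕ)) : Set (List ℕ)).ncard :=
        Set.ncard_le_ncard (fun u hu => by simpa using hu.1) (Finset.finite_toSet _)
    _ = v.inits.toFinset.card := Set.ncard_coe_finset _
    _ ≤ v.inits.length := List.toFinset_card_le _
    _ = v.length + 1 := List.length_inits v
    _ ≤ S.length + 1 := by have := hv.length_le; have := hw.length_le; omega

/-- Apart from its bottom, the stack consists of branching nodes on one path of the suffix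
tree. -/
lemma IsMonoStack.depth_le_height (hT : IsText σ T) (hSA : IsSuffixArray (revText T) SA)
    {j D : ℕ} {idx : ℕ → ℕ} (h : IsMonoStack (lcp T SA) j D idx) (h1 : 1 ≤ j)
    (h2 : j ≤ T.length) : D ≤ suffixTreeHeight (revText T) + 1 := by
  set v := revPrefix T SA j ++ [sentinel] with hv
  set A := {u | u <+: v ∧ IsBranchingNode (revText T) u} with hA
  have hnode : ∀ d ∈ Finset.Icc 2 D, ∃ u ∈ A, (u.length : ℤ) = lcp T SA (idx d) := by
    intro d hd
    obtain ⟨hd1, hd2⟩ := Finset.mem_Icc.1 hd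
    have hs2 : 2 ≤ idx d := hd1.trans (h.le_idx (by omega) hd2)
    have hsj : idx d ≤ j := h.idx_le (by omega) hd2
    obtain ⟨u, hu, hus⟩ := exists_prefix_length_eq_lcp (T := T) (SA := SA) hs2
    have huj : u <+: revPrefix T SA j := prefix_of_le_lcp' (by omega) hsj (fun k h3 h4 => by
      rw [hu]; exact (h.val_lt_of_lt (by omega) hd2 h3 h4).le) hus
    have hlen : u.length = lcpLength (revPrefix T SA (idx d)) (revPrefix T SA (idx d - 1)) := by
      rw [lcp_eq (by omega)] at hu; exact_mod_cast hu
    have hus' := (prefix_iff_le_lcpLength (revPrefix T SA (idx d - 1)) hus).2 hlen.le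
    have hne : revPrefix T SA (idx d) ≠ revPrefix T SA (idx d - 1) := by
      intro hc
      have := revPrefix_lt hT hSA (show 1 ≤ idx d - 1 by omega) (show idx d - 1 < idx d by omega)
        (by omega)
      rw [hc] at this
      exact lt_irrefl _ this
    obtain ⟨x, y, hxy, hx, hy⟩ := exists_branch hus hus' hlen hne
      (sentinel_notMem_revPrefix hT hSA (by omega) (by omega))
      (sentinel_notMem_revPrefix hT hSA (by omega) (by omega))
    exact ⟨u, ⟨huj.trans (List.prefix_append _ _), x, y, hxy,
      ⟨_, revPrefix_suffix hT hSA (by omega) (by omega), hx⟩,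
      ⟨_, revPrefix_suffix hT hSA (by omega) (by omega), hy⟩⟩, hu⟩
  choose! f hfA hf using hnode
  have hinj : Set.InjOn f (Finset.Icc 2 D : Finset ℕ) := by
    intro a ha b hb hab
    have ha' := Finset.mem_Icc.1 ha
    have hb' := Finset.mem_Icc.1 hb
    have hL : lcp T SA (idx a) = lcp T SA (idx b) := by rw [← hf a ha, ← hf b hb, hab]
    rcases lt_trichotomy a b with hlt | rfl | hlt
    · exact absurd hL (h.val_lt a b (by omega) hlt hb'.2).ne
    · rfl
    · exact absurd hL (h.val_lt b a (by omega) hlt ha'.2).ne'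
  have hcard : D - 1 ≤ A.ncard := by
    have := Set.ncard_le_ncard_of_injOn f (s := (Finset.Icc 2 D : Finset ℕ)) (t := A)
      (fun d hd => hfA d hd) hinj (finite_branching_prefixes _ _)
    rw [Set.ncard_coe_finset, Nat.card_Icc] at this
    omega
  have hle : A.ncard ≤ suffixTreeHeight (revText T) :=
    le_csSup ⟨_, length_mem_upperBounds_branching_depths _⟩ ⟨v, isLeaf_revPrefix hT hSA h1 h2, rfl⟩
  omega

end

/-! ### The program -/

/-- The one-pass program.  Cells below `16` are registers; field `f < 16` of record `k ≥ 1` is the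
cell `16 * k + f`, and pointers to the record `k` are stored as `16 * k`.

Registers: `0` `n`; `1` `σ`; `2` top of the stack; `3` last node; `4` current `LCP` value; `6`, `7`
`BWT` at the previous and at the current index; `8`, `13` `SA` at these indices; `9` record of the
current character; `10` current index; `11` which of the two characters is being treated; `12`
index below the top of the stack; `5`, `14`, `15` scratch.

Fields of the record of a character: `0` event of its last candidate (`0` if there is none), `1`
top of the stack at that time, `2` `LCP` value of that event, `3` node of the candidate, `4` head of
its output list.  Fields of a stack record: `5` index, `6` its `LCP` value.  Fields of a node: `7`
text position, `8` record of its character, `9` next node of the output list. -/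
def program : Program := [
  -- `0`: the stack holds index `1`
  .move (.dir 2) (.const 16),
  .move (.dir 21) (.const 1),
  .move (.dir 22) (.const (-1)),
  .move (.dir 10) (.const 1),
  -- `4`: read the next index
  .jumpEQ (.loc (.dir 10)) (.loc (.dir 0)) 64,
  .add (.dir 10) (.loc (.dir 10)) (.const 1),
  .read .lcp true (.dir 4),
  .read .bwt false (.dir 6),
  .read .bwt true (.dir 7),
  .read .sa false (.dir 8),
  .read .sa true (.dir 13),
  .advance,
  -- `12`: pop the entries that are not smaller
  .add (.dir 5) (.loc (.dir 2)) (.const 6),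
  .jumpLT (.loc (.ind 5)) (.loc (.dir 4)) 16,
  .sub (.dir 2) (.loc (.dir 2)) (.const 16),
  .jumpEQ (.const 0) (.const 0) 12,
  -- `16`: push the index
  .add (.dir 5) (.loc (.dir 2)) (.const 5),
  .move (.dir 12) (.loc (.ind 5)),
  .add (.dir 2) (.loc (.dir 2)) (.const 16),
  .add (.dir 5) (.loc (.dir 2)) (.const 5),
  .move (.ind 5) (.loc (.dir 10)),
  .add (.dir 5) (.loc (.dir 2)) (.const 6),
  .move (.ind 5) (.loc (.dir 4)),
  .jumpEQ (.loc (.dir 6)) (.loc (.dir 7)) 4,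
  .move (.dir 11) (.const 0),
  -- `25`: treat one character; skip it if its last candidate lies in the box
  .add (.dir 9) (.loc (.dir 6)) (.loc (.dir 6)),
  .add (.dir 9) (.loc (.dir 9)) (.loc (.dir 9)),
  .add (.dir 9) (.loc (.dir 9)) (.loc (.dir 9)),
  .add (.dir 9) (.loc (.dir 9)) (.loc (.dir 9)),
  .jumpLT (.loc (.dir 12)) (.loc (.ind 9)) 59,
  -- `30`: is the box of the last candidate still open?
  .jumpEQ (.loc (.ind 9)) (.const 0) 43,
  .add (.dir 5) (.loc (.dir 9)) (.const 1),
  .move (.dir 14) (.loc (.ind 5)),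
  .jumpLT (.loc (.dir 2)) (.loc (.dir 14)) 43,
  .sub (.dir 5) (.loc (.dir 14)) (.const 11),
  .move (.dir 15) (.loc (.ind 5)),
  .jumpLT (.loc (.dir 15)) (.loc (.ind 9)) 38,
  .jumpEQ (.const 0) (.const 0) 43,
  .add (.dir 5) (.loc (.dir 9)) (.const 2),
  .move (.dir 15) (.loc (.ind 5)),
  .add (.dir 5) (.loc (.dir 14)) (.const 6),
  .jumpLT (.loc (.ind 5)) (.loc (.dir 15)) 43,
  .jumpEQ (.const 0) (.const 0) 48,
  -- `43`: a new node
  .add (.dir 3) (.loc (.dir 3)) (.const 16),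
  .add (.dir 5) (.loc (.dir 9)) (.const 3),
  .move (.ind 5) (.loc (.dir 3)),
  .add (.dir 5) (.loc (.dir 3)) (.const 8),
  .move (.ind 5) (.loc (.dir 9)),
  -- `48`: the current event becomes the last candidate
  .add (.dir 5) (.loc (.dir 9)) (.const 3),
  .move (.dir 5) (.loc (.ind 5)),
  .add (.dir 5) (.loc (.dir 5)) (.const 7),
  .sub (.dir 15) (.loc (.dir 0)) (.loc (.dir 8)),
  .add (.dir 15) (.loc (.dir 15)) (.const 1),
  .move (.ind 5) (.loc (.dir 15)),
  .move (.ind 9) (.loc (.dir 10)),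
  .add (.dir 5) (.loc (.dir 9)) (.const 1),
  .move (.ind 5) (.loc (.dir 2)),
  .add (.dir 5) (.loc (.dir 9)) (.const 2),
  .move (.ind 5) (.loc (.dir 4)),
  -- `59`: go on to the second character, or to the next index
  .jumpEQ (.loc (.dir 11)) (.const 1) 4,
  .move (.dir 11) (.const 1),
  .move (.dir 6) (.loc (.dir 7)),
  .move (.dir 8) (.loc (.dir 13)),
  .jumpEQ (.const 0) (.const 0) 25,
  -- `64`: prepend the nodes, the last one first, to the lists of their characters
  .jumpEQ (.loc (.dir 3)) (.const 0) 73,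
  .add (.dir 5) (.loc (.dir 3)) (.const 8),
  .move (.dir 9) (.loc (.ind 5)),
  .add (.dir 9) (.loc (.dir 9)) (.const 4),
  .add (.dir 5) (.loc (.dir 3)) (.const 9),
  .move (.ind 5) (.loc (.ind 9)),
  .move (.ind 9) (.loc (.dir 3)),
  .sub (.dir 3) (.loc (.dir 3)) (.const 16),
  .jumpEQ (.const 0) (.const 0) 64,
  -- `73`: write the lists of the characters `1, …, σ`
  .move (.dir 9) (.const 0),
  .jumpEQ (.loc (.dir 1)) (.const 0) 85,
  .sub (.dir 1) (.loc (.dir 1)) (.const 1),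
  .add (.dir 9) (.loc (.dir 9)) (.const 16),
  .add (.dir 5) (.loc (.dir 9)) (.const 4),
  .move (.dir 3) (.loc (.ind 5)),
  .jumpEQ (.loc (.dir 3)) (.const 0) 74,
  .add (.dir 5) (.loc (.dir 3)) (.const 7),
  .write (.loc (.ind 5)),
  .add (.dir 5) (.loc (.dir 3)) (.const 9),
  .move (.dir 3) (.loc (.ind 5)),
  .jumpEQ (.const 0) (.const 0) 79,
  .halt]

/-! ### Execution of single instructions -/

/-- The memory with registers `r` and with field `f` of record `k` equal to `F f k`. -/
def layout (r : ℕ → ℤ) (F : ℕ → ℕ → ℤ) (a : ℕ) : ℤ := if a < 16 then r a else F (a % 16) (a / 16)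

/-- The machine state with program counter `pc`, memory `layout r F`, head `hd`, output `o`. -/
def cfg (pc : ℕ) (r : ℕ → ℤ) (F : ℕ → ℕ → ℤ) (hd : ℕ) (o : List ℤ) : MState :=
  ⟨pc, layout r F, hd, o⟩

/-- Store `v` in field `f` of record `k`. -/
def setField (F : ℕ → ℕ → ℤ) (f k : ℕ) (v : ℤ) : ℕ → ℕ → ℤ :=
  Function.update F f (Function.update (F f) k v)

@[simp] lemma setField_of_ne {F : ℕ → ℕ → ℤ} {f k f' : ℕ} {v : ℤ} (h : f' ≠ f) :
    setField F f k v f' = F f' := Function.update_of_ne h _ _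

@[simp] lemma setField_same (F : ℕ → ℕ → ℤ) (f k : ℕ) (v : ℤ) :
    setField F f k v f = Function.update (F f) k v := Function.update_self _ _ _

lemma layout_update_reg {r : ℕ → ℤ} {F : ℕ → ℕ → ℤ} {a : ℕ} (ha : a < 16) (v : ℤ) :
    Function.update (layout r F) a v = layout (Function.update r a v) F := by
  funext b
  by_cases hb : b = a
  · subst hb; simp [layout, ha]
  · simp [layout, hb]

lemma layout_update_field {r : ℕ → ℤ} {F : ℕ → ℕ → ℤ} {f k : ℕ} (hf : f < 16) (hk : 1 ≤ k)
    (v : ℤ) : Function.update (layout r F) (16 * k + f) v = layout r (setField F f k v) := by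
  funext b
  by_cases hb : b = 16 * k + f
  · subst hb
    have h1 : (16 * k + f) % 16 = f := by omega
    have h2 : (16 * k + f) / 16 = k := by omega
    simp [layout, h1, h2, show ¬ (16 * k + f < 16) by omega]
  · rw [Function.update_of_ne hb]
    simp only [layout]
    split_ifs with h
    · rfl
    · by_cases h1 : b % 16 = f
      · have h2 : b / 16 ≠ k := by omega
        rw [h1, setField_same, Function.update_of_ne h2]
      · rw [setField_of_ne h1]

/-- In at most `k` steps, a state that satisfies `Q` is reached.  The memory consists of the
registers and of the records `1, …, M`. -/
def Reach (inp : InputArray → ℕ → ℤ) (M W k : ℕ) (s : MState) (Q : MState → Prop) : Prop :=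
  ∃ t ≤ k, ∃ s', run program inp (16 * (M + 1)) W t s = some s' ∧ Q s'

/-- The operand `x` evaluates to `v`. -/
def Src (M : ℕ) (r : ℕ → ℤ) (F : ℕ → ℕ → ℤ) (x : Operand) (v : ℤ) : Prop :=
  x.value (16 * (M + 1)) (layout r F) = some v

section
variable {inp : InputArray → ℕ → ℤ} {M W K pc hd a l : ℕ} {r : ℕ → ℤ} {F : ℕ → ℕ → ℤ}
  {o : List ℤ} {Q : MState → Prop} {x y : Operand} {v w : ℤ}

lemma address_dir (ha : a < 16) (m : ℕ → ℤ) : (Loc.dir a).address (16 * (M + 1)) m = some a :=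
  if_pos (by omega)

lemma address_ind {k f : ℕ} (ha : a < 16) (h : r a = 16 * k + f) (hk : k ≤ M) (hf : f < 16) :
    (Loc.ind a).address (16 * (M + 1)) (layout r F) = some (16 * k + f) := by
  have h1 : layout r F a = ((16 * k + f : ℕ) : ℤ) := by
    rw [layout, if_pos ha, h]; push_cast; rfl
  rw [Loc.address, h1, if_pos ⟨by omega, by omega, by omega⟩, Int.toNat_natCast]

lemma Src.const (c : ℤ) : Src M r F (.const c) c := rfl

lemma Src.reg (h : r a = v) (ha : a < 16 := by decide) : Src M r F (.loc (.dir a)) v := by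
  rw [Src, Operand.value, address_dir ha, Option.map_some, layout, if_pos ha, h]

/-- The register `a` points to the field `f` of the record `k`. -/
lemma Src.field (k f : ℕ) (h : r a = 16 * k + f) (hk : 1 ≤ k ∧ k ≤ M)
    (hf : f < 16 := by decide) (ha : a < 16 := by decide) :
    Src M r F (.loc (.ind a)) (F f k) := by
  rw [Src, Operand.value, address_ind ha h hk.2 hf, Option.map_some, layout, if_neg (by omega)]
  congr 2 <;> omega

lemma Reach.done {s : MState} (h : Q s) : Reach inp M W K s Q := ⟨0, by omega, s, rfl, h⟩

lemma Reach.of_step {s s' : MState} (h : step program inp (16 * (M + 1)) W s = some s')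
    (H : Reach inp M W K s' Q) : Reach inp M W (K + 1) s Q := by
  obtain ⟨t, ht, s₁, hs₁, hQ⟩ := H
  exact ⟨t + 1, by omega, s₁, by rw [run, h]; exact hs₁, hQ⟩

lemma Reach.mono {K' : ℕ} {s : MState} (H : Reach inp M W K s Q) (h : K ≤ K') :
    Reach inp M W K' s Q := by
  obtain ⟨t, ht, H⟩ := H
  exact ⟨t, ht.trans h, H⟩

lemma store_reg (ha : a < 16) (hv : -W ≤ v ∧ v ≤ W) :
    store (16 * (M + 1)) W (.dir a) v (cfg pc r F hd o) =
      some (cfg (pc + 1) (Function.update r a v) F hd o) := by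
  rw [store, if_pos (abs_le.2 hv), address_dir ha]
  simp [cfg, layout_update_reg ha]

lemma Reach.move (hP : program[pc]? = some (.move (.dir a) x)) (hx : Src M r F x v)
    (hv : -W ≤ v ∧ v ≤ W) (h : Reach inp M W K (cfg (pc + 1) (Function.update r a v) F hd o) Q)
    (ha : a < 16 := by decide) :
    Reach inp M W (K + 1) (cfg pc r F hd o) Q := by
  refine .of_step ?_ h
  have hx' : x.value (16 * (M + 1)) (cfg pc r F hd o).mem = some v := hx
  rw [step, show (cfg pc r F hd o).pc = pc from rfl, hP, Option.bind_some, exec, hx',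
    Option.bind_some, store_reg ha hv]

lemma Reach.add (hP : program[pc]? = some (.add (.dir a) x y)) (hx : Src M r F x v)
    (hy : Src M r F y w) (hv : -W ≤ v + w ∧ v + w ≤ W)
    (h : Reach inp M W K (cfg (pc + 1) (Function.update r a (v + w)) F hd o) Q)
    (ha : a < 16 := by decide) :
    Reach inp M W (K + 1) (cfg pc r F hd o) Q := by
  refine .of_step ?_ h
  have hx' : x.value (16 * (M + 1)) (cfg pc r F hd o).mem = some v := hx
  have hy' : y.value (16 * (M + 1)) (cfg pc r F hd o).mem = some w := hy
  rw [step, show (cfg pc r F hd o).pc = pc from rfl, hP, Option.bind_some, exec, hx',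
    Option.bind_some, hy', Option.bind_some, store_reg ha hv]

lemma Reach.sub (hP : program[pc]? = some (.sub (.dir a) x y)) (hx : Src M r F x v)
    (hy : Src M r F y w) (hv : -W ≤ v - w ∧ v - w ≤ W)
    (h : Reach inp M W K (cfg (pc + 1) (Function.update r a (v - w)) F hd o) Q)
    (ha : a < 16 := by decide) :
    Reach inp M W (K + 1) (cfg pc r F hd o) Q := by
  refine .of_step ?_ h
  have hx' : x.value (16 * (M + 1)) (cfg pc r F hd o).mem = some v := hx
  have hy' : y.value (16 * (M + 1)) (cfg pc r F hd o).mem = some w := hy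
  rw [step, show (cfg pc r F hd o).pc = pc from rfl, hP, Option.bind_some, exec, hx',
    Option.bind_some, hy', Option.bind_some, store_reg ha hv]

lemma Reach.read {A : InputArray} {ahead : Bool}
    (hP : program[pc]? = some (.read A ahead (.dir a)))
    (hx : inp A (if ahead then hd + 1 else hd) = v) (hv : -W ≤ v ∧ v ≤ W)
    (h : Reach inp M W K (cfg (pc + 1) (Function.update r a v) F hd o) Q)
    (ha : a < 16 := by decide) :
    Reach inp M W (K + 1) (cfg pc r F hd o) Q := by
  refine .of_step ?_ h
  subst hx
  rw [step, show (cfg pc r F hd o).pc = pc from rfl, hP, Option.bind_some, exec,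
    show (cfg pc r F hd o).head = hd from rfl, store_reg ha hv]

/-- Store `x` in the field `f` of the record `k`, to which the register `a` points. -/
lemma Reach.store (k f : ℕ) (hP : program[pc]? = some (.move (.ind a) x)) (hx : Src M r F x v)
    (hr : r a = 16 * k + f) (hk : 1 ≤ k ∧ k ≤ M) (hv : -W ≤ v ∧ v ≤ W)
    (h : Reach inp M W K (cfg (pc + 1) r (setField F f k v) hd o) Q)
    (hf : f < 16 := by decide) (ha : a < 16 := by decide) :
    Reach inp M W (K + 1) (cfg pc r F hd o) Q := by
  refine .of_step ?_ h
  have hx' : x.value (16 * (M + 1)) (cfg pc r F hd o).mem = some v := hx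
  rw [step, show (cfg pc r F hd o).pc = pc from rfl, hP, Option.bind_some, exec, hx',
    Option.bind_some, Suffixient.store, if_pos (abs_le.2 hv),
    show (cfg pc r F hd o).mem = layout r F from rfl, address_ind ha hr hk.2 hf, Option.map_some,
    layout_update_field hf hk.1]
  rfl

/-- Store `x` in the field `f` of the record `k`, addressed directly. -/
lemma Reach.store_dir (k f : ℕ) (hP : program[pc]? = some (.move (.dir (16 * k + f)) x))
    (hx : Src M r F x v) (hk : 1 ≤ k ∧ k ≤ M) (hv : -W ≤ v ∧ v ≤ W)
    (h : Reach inp M W K (cfg (pc + 1) r (setField F f k v) hd o) Q) (hf : f < 16 := by decide) :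
    Reach inp M W (K + 1) (cfg pc r F hd o) Q := by
  refine .of_step ?_ h
  have hx' : x.value (16 * (M + 1)) (cfg pc r F hd o).mem = some v := hx
  rw [step, show (cfg pc r F hd o).pc = pc from rfl, hP, Option.bind_some, exec, hx',
    Option.bind_some, Suffixient.store, if_pos (abs_le.2 hv),
    show (cfg pc r F hd o).mem = layout r F from rfl, Loc.address, if_pos (by omega),
    Option.map_some, layout_update_field hf hk.1]
  rfl

lemma Reach.jumpLT (hP : program[pc]? = some (.jumpLT x y l)) (hx : Src M r F x v)
    (hy : Src M r F y w) (h1 : v < w → Reach inp M W K (cfg l r F hd o) Q)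
    (h2 : w ≤ v → Reach inp M W K (cfg (pc + 1) r F hd o) Q) :
    Reach inp M W (K + 1) (cfg pc r F hd o) Q := by
  have hx' : x.value (16 * (M + 1)) (cfg pc r F hd o).mem = some v := hx
  have hy' : y.value (16 * (M + 1)) (cfg pc r F hd o).mem = some w := hy
  refine .of_step (s' := cfg (if v < w then l else pc + 1) r F hd o) ?_ ?_
  · rw [step, show (cfg pc r F hd o).pc = pc from rfl, hP, Option.bind_some, exec, hx',
      Option.bind_some, hy', Option.map_some]
    rfl
  · split_ifs with h
    exacts [h1 h, h2 (not_lt.1 h)]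

lemma Reach.jumpEQ (hP : program[pc]? = some (.jumpEQ x y l)) (hx : Src M r F x v)
    (hy : Src M r F y w) (h1 : v = w → Reach inp M W K (cfg l r F hd o) Q)
    (h2 : v ≠ w → Reach inp M W K (cfg (pc + 1) r F hd o) Q) :
    Reach inp M W (K + 1) (cfg pc r F hd o) Q := by
  have hx' : x.value (16 * (M + 1)) (cfg pc r F hd o).mem = some v := hx
  have hy' : y.value (16 * (M + 1)) (cfg pc r F hd o).mem = some w := hy
  refine .of_step (s' := cfg (if v = w then l else pc + 1) r F hd o) ?_ ?_
  · rw [step, show (cfg pc r F hd o).pc = pc from rfl, hP, Option.bind_some, exec, hx',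
      Option.bind_some, hy', Option.map_some]
    rfl
  · split_ifs with h
    exacts [h1 h, h2 h]

lemma Reach.goto (hP : program[pc]? = some (.jumpEQ (.const 0) (.const 0) l))
    (h : Reach inp M W K (cfg l r F hd o) Q) : Reach inp M W (K + 1) (cfg pc r F hd o) Q :=
  .jumpEQ hP (.const 0) (.const 0) (fun _ => h) (fun hc => absurd rfl hc)

lemma Reach.advance (hP : program[pc]? = some .advance)
    (h : Reach inp M W K (cfg (pc + 1) r F (hd + 1) o) Q) :
    Reach inp M W (K + 1) (cfg pc r F hd o) Q := by
  refine .of_step ?_ h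
  rw [step, show (cfg pc r F hd o).pc = pc from rfl, hP, Option.bind_some, exec]
  rfl

lemma Reach.write (hP : program[pc]? = some (.write x)) (hx : Src M r F x v)
    (h : Reach inp M W K (cfg (pc + 1) r F hd (o ++ [v])) Q) :
    Reach inp M W (K + 1) (cfg pc r F hd o) Q := by
  refine .of_step ?_ h
  have hx' : x.value (16 * (M + 1)) (cfg pc r F hd o).mem = some v := hx
  rw [step, show (cfg pc r F hd o).pc = pc from rfl, hP, Option.bind_some, exec, hx']
  rfl

end

/-! ### The output phase -/

/-- Starting with the pointer `p` and following the links `next`, one visits the nodes of the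
list. -/
def IsLinked (next : ℕ → ℤ) : ℤ → List ℕ → Prop
  | p, [] => p = 0
  | p, a :: l => p = 16 * a ∧ IsLinked next (next a) l

lemma IsLinked.congr {next next' : ℕ → ℤ} {p : ℤ} {l : List ℕ} (h : IsLinked next p l)
    (hl : ∀ a ∈ l, next' a = next a) : IsLinked next' p l := by
  induction l generalizing p with
  | nil => exact h
  | cons a l ih =>
    refine ⟨h.1, ?_⟩
    rw [hl a (by simp)]
    exact ih h.2 fun b hb => hl b (by simp [hb])

section
variable {inp : InputArray → ℕ → ℤ} {M W K hd m : ℕ} {r : ℕ → ℤ} {F : ℕ → ℕ → ℤ}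
  {o : List ℤ} {Q : MState → Prop}

/-- The inner loop of the output phase writes the list that starts at the node in register `3`. -/
lemma reach_write_list {p : ℤ} {l : List ℕ} (hm : m ≤ M) (hW : 16 * (m + 1) ≤ W) (h3 : r 3 = p)
    (hl : IsLinked (F 9) p l) (hM : ∀ a ∈ l, 1 ≤ a ∧ a ≤ m)
    (H : ∀ r' : ℕ → ℤ, (∀ a, a ≠ 3 → a ≠ 5 → r' a = r a) →
      Reach inp M W K (cfg 74 r' F hd (o ++ l.map (F 7))) Q) :
    Reach inp M W (K + 1 + 6 * l.length) (cfg 79 r F hd o) Q := by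
  induction l generalizing r p o with
  | nil =>
    refine .jumpEQ rfl (.reg h3) (.const 0) (fun _ => ?_) (fun h => absurd hl h)
    simpa using H r fun _ _ _ => rfl
  | cons a l ih =>
    obtain ⟨rfl, hl⟩ := hl
    obtain ⟨ha1, ha2⟩ := hM a (by simp)
    have hnext : 0 ≤ F 9 a ∧ F 9 a ≤ 16 * m := by
      cases l with
      | nil => rw [show F 9 a = 0 from hl]; omega
      | cons b l => have := hM b (by simp); rw [hl.1]; omega
    rw [List.length_cons, show K + 1 + 6 * (l.length + 1) = K + 1 + 6 * l.length + 6 by ring]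
    refine .jumpEQ rfl (.reg h3) (.const 0) (fun h => by omega) (fun _ => ?_)
    refine .add rfl (.reg h3) (.const 7) (by omega) ?_
    refine .write rfl (.field a 7 (by simp) (by omega)) ?_
    refine .add rfl (.reg (by simpa using h3)) (.const 9) (by omega) ?_
    refine .move rfl (.field a 9 (by simp) (by omega)) (by omega) ?_
    refine .goto rfl ?_
    refine ih (p := F 9 a) (by simp) hl (fun b hb => hM b (by simp [hb])) fun r' hr' => ?_
    rw [List.append_assoc]
    refine H r' fun b h3 h5 => ?_
    rw [hr' b h3 h5]
    simp [h3, h5]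

/-- The output phase writes the lists of the characters `c + 1, …, c + q`. -/
lemma reach_write_all {σ c q : ℕ} {ls : ℕ → List ℕ} (hm : m ≤ M) (hW : 16 * (m + 1) ≤ W)
    (hc : c + q = σ)
    (hσ : σ ≤ m) (h1 : r 1 = q) (h9 : r 9 = 16 * c)
    (hl : ∀ c, 1 ≤ c → c ≤ σ → IsLinked (F 9) (F 4 c) (ls c))
    (hM : ∀ c, 1 ≤ c → c ≤ σ → ∀ a ∈ ls c, 1 ≤ a ∧ a ≤ m)
    (H : ∀ s : MState, program[s.pc]? = some .halt →
      s.out = o ++ ((List.range' (c + 1) q).flatMap ls).map (F 7) → Q s) :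
    Reach inp M W (2 + 7 * q + 6 * ((List.range' (c + 1) q).flatMap ls).length)
      (cfg 74 r F hd o) Q := by
  induction q generalizing r c o with
  | zero =>
    refine .jumpEQ (K := 1) rfl (.reg h1) (.const 0) (fun _ => .done (H _ rfl ?_))
      (fun h => absurd (by simp) h)
    simp [cfg]
  | succ q ih =>
    have hmem := hM (c + 1) (by omega) (by omega)
    have hlist := hl (c + 1) (by omega) (by omega)
    have hhead : 0 ≤ F 4 (c + 1) ∧ F 4 (c + 1) ≤ 16 * m := by
      cases hls : ls (c + 1) with
      | nil => rw [hls] at hlist; rw [show F 4 (c + 1) = 0 from hlist]; omega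
      | cons b l =>
        rw [hls] at hlist hmem
        have := hmem b (by simp)
        rw [hlist.1]; omega
    rw [List.range'_succ, List.flatMap_cons, List.length_append,
      show ∀ a b, 2 + 7 * (q + 1) + 6 * (a + b) = 2 + 7 * q + 6 * b + 1 + 6 * a + 6 by
        intros; ring]
    refine .mono (K := 2 + 7 * q + 6 * ((List.range' (c + 1 + 1) q).flatMap ls).length + 1 +
      6 * (ls (c + 1)).length + 5) ?_ (by omega)
    push_cast at h1
    refine .jumpEQ rfl (.reg h1) (.const 0) (fun h => by omega) (fun _ => ?_)
    refine .sub rfl (.reg h1) (.const 1) (by omega) ?_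
    refine .add rfl (.reg (by simpa using h9)) (.const 16) (by omega) ?_
    refine .add rfl (.reg (by simp; rfl)) (.const 4) (by omega) ?_
    refine .move rfl (.field (c + 1) 4 (by simp; ring) (by omega)) (by omega) ?_
    refine reach_write_list hm hW (by simp) hlist hmem fun r' hr' => ?_
    refine ih (c := c + 1) (by omega) ?_ ?_ fun s hs ho => H s hs ?_
    · rw [hr' 1 (by decide) (by decide)]; simp
    · rw [hr' 9 (by decide) (by decide)]; simp; ring
    · rw [ho, List.range'_succ, List.flatMap_cons, List.map_append, List.append_assoc]

/-- The linking phase turns the nodes of each character into a linked list. -/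
lemma reach_link {σ N k : ℕ} {char : ℕ → ℕ} (hm : m ≤ M) (hW : 16 * (m + 1) ≤ W)
    (hN : N ≤ m) (hk : k ≤ N)
    (hσ : σ ≤ m) (h3 : r 3 = 16 * k)
    (hchar : ∀ a, 1 ≤ a → a ≤ N → 1 ≤ char a ∧ char a ≤ σ ∧ F 8 a = 16 * char a)
    (hl : ∀ c, 1 ≤ c → c ≤ σ → IsLinked (F 9) (F 4 c)
      ((List.range' (k + 1) (N - k)).filter fun a => char a = c))
    (H : ∀ (r' : ℕ → ℤ) (F' : ℕ → ℕ → ℤ), r' 1 = r 1 → F' 7 = F 7 →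
      (∀ c, 1 ≤ c → c ≤ σ → IsLinked (F' 9) (F' 4 c)
        ((List.range' 1 N).filter fun a => char a = c)) →
      Reach inp M W K (cfg 73 r' F' hd o) Q) :
    Reach inp M W (K + 1 + 9 * k) (cfg 64 r F hd o) Q := by
  induction k generalizing r F with
  | zero =>
    refine .jumpEQ rfl (.reg h3) (.const 0) (fun _ => ?_) (fun h => absurd (by simp) h)
    exact H r F rfl rfl (by simpa using hl)
  | succ k ih =>
    obtain ⟨hc1, hc2, h8⟩ := hchar (k + 1) (by omega) hk
    have hhead : 0 ≤ F 4 (char (k + 1)) ∧ F 4 (char (k + 1)) ≤ 16 * m := by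
      have hlist := hl _ hc1 hc2
      cases hls : (List.range' (k + 1 + 1) (N - (k + 1))).filter
          fun a => char a = char (k + 1) with
      | nil => rw [hls] at hlist; rw [show F 4 _ = 0 from hlist]; omega
      | cons b l =>
        rw [hls] at hlist
        have hb : b ∈ (List.range' (k + 1 + 1) (N - (k + 1))).filter
          fun a => char a = char (k + 1) := by rw [hls]; simp
        have := (List.mem_range'_1.1 (List.mem_filter.1 hb).1)
        rw [hlist.1]; omega
    push_cast at h3
    rw [show K + 1 + 9 * (k + 1) = K + 1 + 9 * k + 9 by ring]
    refine .jumpEQ rfl (.reg h3) (.const 0) (fun h => by omega) (fun _ => ?_)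
    refine .add rfl (.reg h3) (.const 8) (by omega) ?_
    refine .move rfl (.field (k + 1) 8 (by simp) (by omega)) (by omega) ?_
    refine .add rfl (.reg (by simp; exact h8)) (.const 4) (by omega) ?_
    refine .add rfl (.reg (by simp; exact h3)) (.const 9) (by omega) ?_
    refine .store (k + 1) 9 rfl (.field (char (k + 1)) 4 (by simp) (by omega)) (by simp)
      (by omega) (by omega) ?_
    refine .store (char (k + 1)) 4 rfl (.reg (by simp; exact h3)) (by simp) (by omega)
      (by omega) ?_
    refine .sub rfl (.reg (by simp; exact h3)) (.const 16) (by omega) ?_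
    refine .goto rfl ?_
    refine ih (by omega) (by simp; ring) (by simpa using hchar) ?_ ?_
    · intro c h1 h2
      have hrest : IsLinked (setField (setField F 9 (k + 1) (F 4 (char (k + 1)))) 4
          (char (k + 1)) (16 * (k + 1)) 9) (F 4 c)
          ((List.range' (k + 1 + 1) (N - (k + 1))).filter fun a => char a = c) := by
        refine (hl c h1 h2).congr fun a ha => ?_
        have := (List.mem_range'_1.1 (List.mem_filter.1 ha).1)
        simp [show a ≠ k + 1 by omega]
      rw [show N - k = N - (k + 1) + 1 by omega, List.range'_succ]
      by_cases hc : char (k + 1) = c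
      · subst hc
        rw [List.filter_cons_of_pos (by simp)]
        exact ⟨by simp, by simpa using hrest⟩
      · rw [List.filter_cons_of_neg (by simpa using hc)]
        simpa [Ne.symm hc] using hrest
    · intro r' F' hr' hF'
      exact H r' F' (by rw [hr']; simp) (by rw [hF']; simp)

end

/-! ### The scan -/

/-- The record of the character `c` at time `j`: either `c` has no candidate yet, or the fields
`0`, `1`, `2`, `3` describe its last candidate. -/
def IsCharRecord (L : ℕ → ℤ) (m j D : ℕ) (idx : ℕ → ℕ) (N : ℕ) (cand : ℕ → Candidate)
    (F : ℕ → ℕ → ℤ) (c : ℕ) : Prop :=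
  (F 0 c = 0 ∧ ∀ k, 1 ≤ k → k ≤ N → (cand k).char ≠ c) ∨
    ∃ k d₀ : ℕ, IsLastCandidate N cand c k ∧ F 0 c = (cand k).event ∧ F 1 c = 16 * d₀ ∧ d₀ ≤ m ∧
      F 2 c = L (cand k).event ∧ F 3 c = 16 * k ∧ IsDepthMark L j D idx (cand k).event d₀

/-- The fields `F` represent the stack, the characters `1, …, σ` and the nodes `1, …, N`. -/
structure Represents (L : ℕ → ℤ) (SA : ℕ → ℕ) (n σ m j D : ℕ) (idx : ℕ → ℕ) (N : ℕ)
    (cand : ℕ → Candidate) (F : ℕ → ℕ → ℤ) : Prop where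
  stack : ∀ d, 1 ≤ d → d ≤ D → F 5 d = idx d ∧ F 6 d = L (idx d)
  node : ∀ k, 1 ≤ k → k ≤ N →
    F 7 k = (n : ℤ) - SA (cand k).pos + 1 ∧ F 8 k = 16 * (cand k).char
  head : ∀ c, F 4 c = 0
  char : ∀ c, 1 ≤ c → c ≤ σ → IsCharRecord L m j D idx N cand F c

/-- Adding a node for `c`, or changing the last one of `c`, does not affect the record of another
character. -/
lemma IsCharRecord.update_other {L : ℕ → ℤ} {m j D N N' c c' k p j' : ℕ} {idx : ℕ → ℕ}
    {cand : ℕ → Candidate} {F F' : ℕ → ℕ → ℤ} (h : IsCharRecord L m j D idx N cand F c')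
    (hc : c' ≠ c) (hk : (k ≤ N ∧ N' = N ∧ (cand k).char = c) ∨ (k = N + 1 ∧ N' = N + 1))
    (hF : F' 0 c' = F 0 c' ∧ F' 1 c' = F 1 c' ∧ F' 2 c' = F 2 c' ∧ F' 3 c' = F 3 c') :
    IsCharRecord L m j D idx N' (Function.update cand k ⟨c, j', p⟩) F' c' := by
  have hold : ∀ i, i ≠ k → Function.update cand k ⟨c, j', p⟩ i = cand i := fun i hi =>
    Function.update_of_ne hi _ _
  rcases h with ⟨h0, hno⟩ | ⟨i, d₀, ⟨hi1, hi2, hi3, hi4⟩, h0, h1, hd, h2, h3, hm⟩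
  · refine Or.inl ⟨by rw [hF.1, h0], fun i h1 h2 => ?_⟩
    by_cases hik : i = k
    · subst hik; simpa using hc.symm
    · rw [hold i hik]; exact hno i h1 (by omega)
  · have hik : i ≠ k := by
      rintro rfl
      rcases hk with hk | hk
      · exact hc (hi3.symm.trans hk.2.2)
      · omega
    refine Or.inr ⟨i, d₀, ⟨hi1, by omega, by rwa [hold i hik], fun q hq1 hq2 hq3 => ?_⟩, ?_⟩
    · by_cases hqk : q = k
      · subst hqk; exact absurd (by simpa using hq3.symm) hc
      · rw [hold q hqk] at hq3; exact hi4 q hq1 (by omega) hq3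
    · rw [hold i hik, hF.1, hF.2.1, hF.2.2.1, hF.2.2.2]
      exact ⟨h0, h1, hd, h2, h3, hm⟩

section
variable {σ n M W K hd m j D N c p : ℕ} {SA : ℕ → ℕ} {B : ℕ → ℕ} {L : ℕ → ℤ}
  {inp : InputArray → ℕ → ℤ} {r : ℕ → ℤ} {F : ℕ → ℕ → ℤ} {o : List ℤ} {Q : MState → Prop}
  {idx : ℕ → ℕ} {cand : ℕ → Candidate} {E : ℕ → ℕ → Prop}

/-- The memory after the event `(j, c)` has been recorded in the node `k`. -/
def recordEvent (F : ℕ → ℕ → ℤ) (c k j D : ℕ) (x ℓ : ℤ) : ℕ → ℕ → ℤ :=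
  setField (setField (setField (setField F 7 k x) 0 c j) 1 c (16 * D)) 2 c ℓ

/-- The instructions `48`–`58` record the current event in the node of the current character. -/
lemma reach_record {k s : ℕ} {ℓ : ℤ} (hm : m ≤ M) (hW : 16 * (m + 1) ≤ W) (hn : n + 1 ≤ W)
    (h0 : r 0 = n) (h2 : r 2 = 16 * D) (h4 : r 4 = ℓ) (h8 : r 8 = s) (h9 : r 9 = 16 * c)
    (h10 : r 10 = j) (hF : F 3 c = 16 * k) (hc : 1 ≤ c ∧ c ≤ m) (hk : 1 ≤ k ∧ k ≤ m)
    (hD : D ≤ m) (hj : j ≤ n) (hs : s ≤ n) (hℓ : -n ≤ ℓ ∧ ℓ ≤ n)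
    (H : ∀ r' : ℕ → ℤ, (∀ a, a ≠ 5 → a ≠ 15 → r' a = r a) →
      Reach inp M W K (cfg 59 r' (recordEvent F c k j D (n - s + 1) ℓ) hd o) Q) :
    Reach inp M W (K + 11) (cfg 48 r F hd o) Q := by
  refine .add rfl (.reg h9) (.const 3) (by omega) ?_
  refine .move rfl (.field c 3 (by simp) (by omega)) (by omega) ?_
  refine .add rfl (.reg (by simp; exact hF)) (.const 7) (by omega) ?_
  refine .sub rfl (.reg (by simp; exact h0)) (.reg (by simp; exact h8)) (by omega) ?_
  refine .add rfl (.reg (by simp; rfl)) (.const 1) (by omega) ?_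
  refine .store k 7 rfl (.reg (by simp; rfl)) (by simp) (by omega) (by omega) ?_
  refine .store c 0 rfl (.reg (by simp; exact h10)) (by simp [h9]) (by omega) (by omega) ?_
  refine .add rfl (.reg (by simp; exact h9)) (.const 1) (by omega) ?_
  refine .store c 1 rfl (.reg (by simp; exact h2)) (by simp) (by omega) (by omega) ?_
  refine .add rfl (.reg (by simp; exact h9)) (.const 2) (by omega) ?_
  refine .store c 2 rfl (.reg (by simp; exact h4)) (by simp) (by omega) (by omega) ?_
  exact H _ fun a h5 h15 => by simp [h5, h15]

/-- The memory after an event has been recorded in the node `k`, which is the last node of `c` or a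
new one. -/
lemma Represents.record {k N' : ℕ} {F : ℕ → ℕ → ℤ} (hst : IsMonoStack L j D idx) (hD : 2 ≤ D)
    (hDm : D ≤ m) (hk1 : 1 ≤ k) (hF3 : F 3 c = 16 * k) (hF8 : F 8 k = 16 * c)
    (hk : (k ≤ N ∧ N' = N ∧ (cand k).char = c) ∨ (k = N + 1 ∧ N' = N + 1))
    (hlast : ∀ k', 1 ≤ k' → k' ≤ N → (cand k').char = c → k' ≤ k)
    (stack : ∀ d, 1 ≤ d → d ≤ D → F 5 d = idx d ∧ F 6 d = L (idx d))
    (node : ∀ k', k' ≠ k → 1 ≤ k' → k' ≤ N →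
      F 7 k' = (n : ℤ) - SA (cand k').pos + 1 ∧ F 8 k' = 16 * (cand k').char)
    (head : ∀ c, F 4 c = 0)
    (char : ∀ c', c' ≠ c → 1 ≤ c' → c' ≤ σ → IsCharRecord L m j D idx N cand F c') :
    Represents L SA n σ m j D idx N' (Function.update cand k ⟨c, j, p⟩)
      (recordEvent F c k j D (n - SA p + 1) (L j)) where
  stack := by simpa [recordEvent] using stack
  head := by simpa [recordEvent] using head
  node := fun k' h1 h2 => by
    by_cases hkk : k' = k
    · subst hkk; simp [recordEvent, hF8]
    · simpa [recordEvent, hkk] using node k' hkk h1 (by omega)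
  char := fun c' h1 h2 => by
    by_cases hc : c' = c
    · subst hc
      refine Or.inr ⟨k, D, ⟨hk1, by omega, by simp, fun q hq1 hq2 hq3 => ?_⟩, ?_⟩
      · by_cases hqk : q = k
        · exact hqk.le
        · rw [Function.update_of_ne hqk] at hq3
          exact hlast q hq1 (by omega) hq3
      · simpa [recordEvent, hF3, hDm] using IsDepthMark.of_top hst hD
    · exact (char c' hc h1 h2).update_other hc hk (by simp [recordEvent, hc])

/-- The instructions `25`–`58` treat the event `(j, c)`. -/
lemma reach_event (hm : m ≤ M) (hW : 16 * (m + 1) ≤ W) (hn : n + 1 ≤ W)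
    (hL : ∀ i, -n ≤ L i ∧ L i ≤ n) (hσ : σ ≤ m) (hSA : SA p ≤ n)
    (hN : ∀ E N cand, IsCandidateList B L j E N cand → N ≤ m)
    (h0 : r 0 = n) (h2 : r 2 = 16 * D) (h3 : r 3 = 16 * N) (h4 : r 4 = L j) (h6 : r 6 = c)
    (h8 : r 8 = SA p) (h10 : r 10 = j) (h12 : r 12 = idx (D - 1))
    (hst : IsMonoStack L j D idx) (hD : 2 ≤ D) (hDm : D ≤ m) (hj : j ≤ n)
    (hrep : Represents L SA n σ m j D idx N cand F) (hcand : IsCandidateList B L j E N cand)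
    (hc : 1 ≤ c ∧ c ≤ σ) (hch : B (j - 1) ≠ B j) (hp : p = j ∨ p = j - 1) (hB : B p = c)
    (H : ∀ (r' : ℕ → ℤ) F' N' cand',
      (∀ a, a ≠ 3 → a ≠ 5 → a ≠ 9 → a ≠ 14 → a ≠ 15 → r' a = r a) → r' 3 = 16 * (N' : ℕ) →
      Represents L SA n σ m j D idx N' cand' F' →
      IsCandidateList B L j (fun i c' => E i c' ∨ (i = j ∧ c' = c)) N' cand' →
      Reach inp M W K (cfg 59 r' F' hd o) Q) :
    Reach inp M W (K + 34) (cfg 25 r F hd o) Q := by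
  have hj2 : 2 ≤ j := hD.trans hst.depth_le
  obtain ⟨hl1, hl2, hl3⟩ := hst.prev_spec hD
  have hNm := hN _ _ _ hcand
  -- the event moves the candidate of its character
  have hrepl : ∀ r' : ℕ → ℤ,
      (∀ a, a ≠ 3 → a ≠ 5 → a ≠ 9 → a ≠ 14 → a ≠ 15 → r' a = r a) → r' 3 = r 3 → r' 9 = 16 * c →
      ∀ k, IsLastCandidate N cand c k → F 3 c = 16 * k →
      (∃ a, (cand k).event ≤ a ∧ a < j ∧ L a < L j) →
      (∀ a, (cand k).event < a → a ≤ j → L (cand k).event ≤ L a) →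
      Reach inp M W (K + 11) (cfg 48 r' F hd o) Q := by
    intro r' hr' hr3 hr9 k hk hF3 hlt hopen
    have hk1 := hk.1
    have hk2 := hk.2.1
    refine reach_record (c := c) (k := k) (s := SA p) hm hW hn (by simp [hr', h0])
      (by simp [hr', h2]) (by simp [hr', h4]) (by simp [hr', h8]) hr9 (by simp [hr', h10])
      hF3 (by omega) (by omega) hDm hj hSA (hL j) fun r'' hr'' => ?_
    refine H r'' _ N (Function.update cand k ⟨c, j, p⟩) ?_ ?_ ?_
      (hcand.replace hj2 hch hp hB hk hlt hopen)
    · intro a h3 h5 h9 h14 h15; rw [hr'' a h5 h15, hr' a h3 h5 h9 h14 h15]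
    · rw [hr'' 3 (by decide) (by decide), hr3, h3]
    · exact .record hst hD hDm hk1 hF3 (by rw [(hrep.node k hk1 hk2).2, hk.2.2.1])
        (Or.inl ⟨hk2, rfl, hk.2.2.1⟩) hk.2.2.2 hrep.stack (fun k' _ => hrep.node k') hrep.head
        (fun c' _ => hrep.char c')
  -- the event gets a new node
  have happ : ∀ r' : ℕ → ℤ,
      (∀ a, a ≠ 3 → a ≠ 5 → a ≠ 9 → a ≠ 14 → a ≠ 15 → r' a = r a) → r' 3 = r 3 → r' 9 = 16 * c →
      ((∀ k, 1 ≤ k → k ≤ N → (cand k).char ≠ c) ∨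
        ∃ k, IsLastCandidate N cand c k ∧ (∃ a, (cand k).event ≤ a ∧ a < j ∧ L a < L j) ∧
          ∃ a, (cand k).event < a ∧ a ≤ j ∧ L a < L (cand k).event) →
      Reach inp M W (K + 16) (cfg 43 r' F hd o) Q := by
    intro r' hr' hr3 hr9 hlast
    have hcand' := hcand.append hj2 hch hp hB hlast
    have hNm' := hN _ _ _ hcand'
    refine .add rfl (.reg (by rw [hr3, h3])) (.const 16) (by omega) ?_
    refine .add rfl (.reg (by simp; exact hr9)) (.const 3) (by omega) ?_
    refine .store c 3 rfl (.reg (by simp; rfl)) (by simp) (by omega) (by omega) ?_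
    refine .add rfl (.reg (by simp; rfl)) (.const 8) (by omega) ?_
    refine .store (N + 1) 8 rfl (.reg (by simp; exact hr9)) (by simp; ring) (by omega)
      (by omega) ?_
    refine reach_record (c := c) (k := N + 1) (s := SA p) hm hW hn (by simp [hr', h0])
      (by simp [hr', h2]) (by simp [hr', h4]) (by simp [hr', h8]) (by simp [hr9])
      (by simp [hr', h10])
      (by simp; ring) (by omega) (by omega) hDm hj hSA (hL j) fun r'' hr'' => ?_
    refine H r'' _ (N + 1) (Function.update cand (N + 1) ⟨c, j, p⟩) ?_ ?_ ?_ hcand'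
    · intro a h3 h5 h9 h14 h15
      rw [hr'' a h5 h15]
      simp [h3, h5, hr' a h3 h5 h9 h14 h15]
    · rw [hr'' 3 (by decide) (by decide)]; simp; ring
    · refine .record hst hD hDm (by omega) (by simp; ring) (by simp) (Or.inr ⟨rfl, rfl⟩)
        (fun k' _ h _ => by omega) (by simpa using hrep.stack) (fun k' hk' h1 h2 => ?_)
        (by simpa using hrep.head) (fun c' hc' h1 h2 => ?_)
      · simpa [hk'] using hrep.node k' h1 h2
      · simpa [IsCharRecord, hc'] using hrep.char c' h1 h2
  have hF0 : F 0 c = 0 ∨ 0 < F 0 c := by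
    rcases hrep.char c hc.1 hc.2 with ⟨h, -⟩ | ⟨k, d₀, hk, h, -⟩
    · exact Or.inl h
    · have := hcand.event_ge k hk.1 hk.2.1; omega
  refine .add rfl (.reg h6) (.reg h6) (by omega) ?_
  refine .add rfl (.reg (by simp; rfl)) (.reg (by simp; rfl)) (by omega) ?_
  refine .add rfl (.reg (by simp; rfl)) (.reg (by simp; rfl)) (by omega) ?_
  refine .add rfl (.reg (by simp; rfl)) (.reg (by simp; rfl)) (by omega) ?_
  -- the four doublings have computed the address of the record of `c`
  have h16 : ((c : ℤ) + c + (c + c) + (c + c + (c + c))) +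
    (c + c + (c + c) + (c + c + (c + c))) = 16 * c := by ring
  simp only [Function.update_idem, h16]
  refine .jumpLT rfl (.reg (by simp; exact h12)) (.field c 0 (by simp) (by omega)) ?_ ?_
  · intro hlt
    rcases hrep.char c hc.1 hc.2 with ⟨h, -⟩ | ⟨k, d₀, hk, h, -⟩
    · omega
    · refine .mono (K := K) (H _ F N cand ?_ (by simp [h3]) hrep
        (hcand.skip hk fun a h5 h7 => hl3 a (by omega) h7.le)) (by omega)
      intro a _ _ h9 _ _
      simp [h9]
  intro hge
  refine .jumpEQ rfl (.field c 0 (by simp) (by omega)) (.const 0) ?_ ?_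
  · intro hz
    refine .mono (happ _ ?_ (by simp) (by simp) (Or.inl ?_)) (show K + 16 ≤ K + 28 by omega)
    · intro a _ _ h9 _ _; simp [h9]
    · rcases hrep.char c hc.1 hc.2 with ⟨-, h⟩ | ⟨k, d₀, hk, h, -⟩
      · exact h
      · have := hcand.event_ge k hk.1 hk.2.1; omega
  intro hnz
  obtain ⟨k, d₀, hk, hF0, hF1, hd₀, hF2, hF3, hmark⟩ : ∃ k d₀ : ℕ, IsLastCandidate N cand c k ∧
      F 0 c = (cand k).event ∧ F 1 c = 16 * d₀ ∧ d₀ ≤ m ∧ F 2 c = L (cand k).event ∧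
      F 3 c = 16 * k ∧ IsDepthMark L j D idx (cand k).event d₀ := by
    rcases hrep.char c hc.1 hc.2 with ⟨h, -⟩ | h
    · exact absurd h hnz
    · exact h
  have hev := hcand.event_ge k hk.1 hk.2.1
  have hevj := hcand.event_le k hk.1 hk.2.1
  have hlt : ∃ a, (cand k).event ≤ a ∧ a < j ∧ L a < L j := ⟨_, by omega, hl1, hl2⟩
  have hopen := hmark.open_iff hst (by omega)
  have hd2 := hmark.two_le
  have hclosed : ¬ (d₀ ≤ D ∧ idx (d₀ - 1) < (cand k).event ∧ L (cand k).event ≤ L (idx d₀)) →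
      ((∀ k, 1 ≤ k → k ≤ N → (cand k).char ≠ c) ∨
        ∃ k, IsLastCandidate N cand c k ∧ (∃ a, (cand k).event ≤ a ∧ a < j ∧ L a < L j) ∧
          ∃ a, (cand k).event < a ∧ a ≤ j ∧ L a < L (cand k).event) := by
    intro h
    rw [← hopen] at h
    push Not at h
    exact Or.inr ⟨k, hk, hlt, h⟩
  have hLk := hL (cand k).event
  refine .add rfl (.reg (by simp; rfl)) (.const 1) (by omega) ?_
  refine .move rfl (.field c 1 (by simp) (by omega)) (by omega) ?_
  refine .jumpLT rfl (.reg (by simp; exact h2)) (.reg (by simp; exact hF1)) ?_ ?_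
  · intro h
    refine .mono (happ _ ?_ (by simp) (by simp) (hclosed fun h' => by omega))
      (show K + 16 ≤ K + 25 by omega)
    intro a _ h5 h9 h14 _; simp [h5, h9, h14]
  intro hdD
  have hdD : d₀ ≤ D := by omega
  have hs1 := hrep.stack (d₀ - 1) (by omega) (by omega)
  have hs2 := hrep.stack d₀ (by omega) hdD
  have hi := hst.idx_le (show 1 ≤ d₀ - 1 by omega) (by omega)
  have hpred : ((d₀ - 1 : ℕ) : ℤ) = d₀ - 1 := by omega
  refine .sub rfl (.reg (by simp; exact hF1)) (.const 11) (by omega) ?_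
  refine .move rfl (.field (d₀ - 1) 5 (by simp [hpred]; ring) (by omega)) (by omega) ?_
  -- the index below level `d₀` is before the event: only the `LCP` values are left to compare
  have hbranch : ∀ r' : ℕ → ℤ,
      (∀ a, a ≠ 3 → a ≠ 5 → a ≠ 9 → a ≠ 14 → a ≠ 15 → r' a = r a) → r' 3 = r 3 → r' 9 = 16 * c →
      r' 14 = 16 * d₀ → idx (d₀ - 1) < (cand k).event →
      Reach inp M W (K + 16 + 5) (cfg 38 r' F hd o) Q := by
    intro r' hr' hr3 hr9 hr14 hi₀
    refine .add rfl (.reg hr9) (.const 2) (by omega) ?_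
    refine .move rfl (.field c 2 (by simp) (by omega)) (by omega) ?_
    refine .add rfl (.reg (by simp; exact hr14)) (.const 6) (by omega) ?_
    refine .jumpLT rfl (.field d₀ 6 (by simp) (by omega)) (.reg (by simp; exact hF2)) ?_ ?_
    · intro h
      refine .mono (happ _ ?_ (by simp [hr3]) (by simp [hr9]) (hclosed fun h' => by omega))
        (show K + 16 ≤ K + 17 by omega)
      intro a h3 h5 h9 h14 h15; simp [h5, h15, hr' a h3 h5 h9 h14 h15]
    · intro h
      refine .goto rfl (.mono (hrepl _ ?_ (by simp [hr3]) (by simp [hr9]) k hk hF3 hlt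
        (hopen.2 ⟨hdD, hi₀, by omega⟩)) (show K + 11 ≤ K + 16 by omega))
      intro a h3 h5 h9 h14 h15; simp [h5, h15, hr' a h3 h5 h9 h14 h15]
  refine .jumpLT rfl (.reg (by simp; rfl)) (.field c 0 (by simp) (by omega)) ?_ ?_
  · intro h
    refine .mono (hbranch _ ?_ (by simp) (by simp) (by simp [hF1]) (by omega))
      (show K + 16 + 5 ≤ K + 22 by omega)
    intro a _ h5 h9 h14 h15; simp [h5, h9, h14, h15]
  · intro h
    refine .goto rfl (.mono (happ _ ?_ (by simp) (by simp) (hclosed fun h' => by omega))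
      (show K + 16 ≤ K + 21 by omega))
    intro a _ h5 h9 h14 h15; simp [h5, h9, h14, h15]

/-- The pop loop, which ends at the latest at the bottom of the stack; `m` bounds the number of
records in use. -/
lemma reach_pop {ℓ : ℤ} (hm : m ≤ M) (hW : 16 * (m + 1) ≤ W) (hD1 : 1 ≤ D) (hDm : D ≤ m)
    (h2 : r 2 = 16 * D) (h4 : r 4 = ℓ)
    (hstack : ∀ d, 1 ≤ d → d ≤ D → F 6 d = L (idx d)) (hbot : L (idx 1) < ℓ)
    (H : ∀ (r' : ℕ → ℤ) (D' : ℕ), (∀ a, a ≠ 2 → a ≠ 5 → r' a = r a) → r' 2 = 16 * D' → 1 ≤ D' →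
      D' ≤ D → L (idx D') < ℓ → (∀ d, D' < d → d ≤ D → ℓ ≤ L (idx d)) →
      Reach inp M W (K + 4 * D') (cfg 16 r' F hd o) Q) :
    Reach inp M W (K + 4 * D + 2) (cfg 12 r F hd o) Q := by
  induction D, hD1 using Nat.le_induction generalizing r with
  | base =>
    refine .add rfl (.reg h2) (.const 6) (by omega) ?_
    refine .jumpLT rfl (.field 1 6 (by simp) (by omega)) (.reg (by simp; exact h4)) ?_ ?_
    · intro _
      exact H _ 1 (fun a h2 h5 => by simp [h5]) (by simpa using h2) le_rfl le_rfl hbot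
        (fun d _ _ => by omega)
    · intro h
      rw [hstack 1 le_rfl le_rfl] at h
      omega
  | succ D hD1 ih =>
    refine .add rfl (.reg h2) (.const 6) (by omega) ?_
    refine .jumpLT rfl (.field (D + 1) 6 (by simp) (by omega)) (.reg (by simp; exact h4)) ?_ ?_
    · intro h
      rw [hstack (D + 1) (by omega) le_rfl] at h
      exact H _ (D + 1) (fun a h2 h5 => by simp [h5]) (by simpa using h2) (by omega) le_rfl h
        (fun d _ _ => by omega)
    · intro h
      rw [hstack (D + 1) (by omega) le_rfl] at h
      push_cast at h2
      rw [show K + 4 * (D + 1) = K + 4 * D + 2 + 1 + 1 by ring]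
      refine .sub rfl (.reg (by simp; exact h2)) (.const 16) (by omega) ?_
      refine .goto rfl (ih (by omega) (by simp; ring) (by simpa using h4)
        (fun d h1 h2 => hstack d h1 (by omega)) ?_)
      intro r' D' hr' hr2 h1 h2 h3 h4
      refine H r' D' (fun a ha2 ha5 => ?_) hr2 h1 (by omega) h3 fun d hd1 hd2 => ?_
      · rw [hr' a ha2 ha5]; simp [ha2, ha5]
      · rcases hd2.eq_or_lt with rfl | hd2
        · exact h
        · exact h4 d hd1 (by omega)

end

section
variable {σ M W K m j D D' N : ℕ} {T : List ℕ} {SA : ℕ → ℕ} {r : ℕ → ℤ} {F : ℕ → ℕ → ℤ}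
  {Q : MState → Prop} {idx : ℕ → ℕ} {cand : ℕ → Candidate}

lemma inputStream_of_mem (A : InputArray) {i : ℕ} (h1 : 1 ≤ i) (h2 : i ≤ T.length) :
    inputStream T SA A i = match A with
      | .bwt => (bwt T SA i : ℤ)
      | .sa => (SA i : ℤ)
      | .lcp => lcp T SA i := if_pos ⟨h1, h2⟩

/-- The instructions `16`–`22` push the current index and keep the index below it in register
`12`. -/
lemma reach_push {inp : InputArray → ℕ → ℤ} {hd n : ℕ} {o : List ℤ} {ℓ : ℤ} (hm : m ≤ M)
    (hW : 16 * (m + 1) ≤ W) (hn : n + 1 ≤ W)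
    (hD1 : 1 ≤ D) (hDm : D + 1 ≤ m) (hj : j ≤ n) (hℓ : -n ≤ ℓ ∧ ℓ ≤ n) (hidx : idx D ≤ n)
    (h2 : r 2 = 16 * D) (h4 : r 4 = ℓ) (h10 : r 10 = j) (hF : F 5 D = idx D)
    (H : ∀ r' : ℕ → ℤ, (∀ a, a ≠ 2 → a ≠ 5 → a ≠ 12 → r' a = r a) →
      r' 2 = 16 * (D + 1 : ℕ) → r' 12 = idx D →
      Reach inp M W K (cfg 23 r' (setField (setField F 5 (D + 1) j) 6 (D + 1) ℓ) hd o) Q) :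
    Reach inp M W (K + 7) (cfg 16 r F hd o) Q := by
  refine .add rfl (.reg h2) (.const 5) (by omega) ?_
  refine .move rfl (.field D 5 (by simp) (by omega)) (by omega) ?_
  refine .add rfl (.reg (by simp; exact h2)) (.const 16) (by omega) ?_
  refine .add rfl (.reg (by simp; rfl)) (.const 5) (by omega) ?_
  refine .store (D + 1) 5 rfl (.reg (by simp; exact h10)) (by simp; ring) (by omega)
    (by omega) ?_
  refine .add rfl (.reg (by simp; rfl)) (.const 6) (by omega) ?_
  refine .store (D + 1) 6 rfl (.reg (by simp; exact h4)) (by simp; ring) (by omega)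
    (by omega) ?_
  refine H _ (fun a h2 h5 h12 => by simp [h2, h5, h12]) (by simp; ring) (by simp [hF])

lemma Represents.push {L : ℕ → ℤ} {n : ℕ} (h : Represents L SA n σ m j D idx N cand F)
    (hst : IsMonoStack L j D idx) (h2 : D' ≤ D)
    (hpop : ∀ d, D' < d → d ≤ D → L (j + 1) ≤ L (idx d)) :
    Represents L SA n σ m (j + 1) (D' + 1) (Function.update idx (D' + 1) (j + 1)) N cand
      (setField (setField F 5 (D' + 1) (j + 1 : ℕ)) 6 (D' + 1) (L (j + 1))) where
  stack := fun d hd1 hd2 => by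
    rcases hd2.eq_or_lt with rfl | hd2
    · simp
    · simpa [show d ≠ D' + 1 by omega] using h.stack d hd1 (by omega)
  node := by simpa using h.node
  head := by simpa using h.head
  char := fun c hc1 hc2 => by
    rcases h.char c hc1 hc2 with hc | ⟨k, d₀, hk, hF0, hF1, hd, hF2, hF3, hmark⟩
    · exact Or.inl (by simpa using hc)
    · exact Or.inr ⟨k, d₀, hk, by simpa using hF0, by simpa using hF1, hd, by simpa using hF2,
        by simpa using hF3, hmark.push hst h2 hpop⟩

/-- The loop invariant of the scan, after index `j`. -/
structure ScanInvariant (T : List ℕ) (SA : ℕ → ℕ) (σ m j D N : ℕ) (idx : ℕ → ℕ)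
    (cand : ℕ → Candidate) (r : ℕ → ℤ) (F : ℕ → ℕ → ℤ) : Prop where
  len : r 0 = T.length
  alphabet : r 1 = σ
  top : r 2 = 16 * D
  node : r 3 = 16 * N
  index : r 10 = j
  stack : IsMonoStack (lcp T SA) j D idx
  represents : Represents (lcp T SA) SA T.length σ m j D idx N cand F
  candidates : IsCandidateList (bwt T SA) (lcp T SA) j (fun i c => IsEvent T SA i c ∧ i ≤ j) N cand

/-- One round of the scan.  The steps for popping are paid for by the depth of the stack. -/
lemma reach_next (hT : IsText σ T) (hSA : IsSuffixArray (revText T) SA) (hm : m ≤ M)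
    (hW : 16 * (m + 1) ≤ W) (hn : T.length + 1 ≤ W) (hσ : σ ≤ m)
    (hdepth : suffixTreeHeight (revText T) + 1 ≤ m)
    (hN : ∀ j E N cand, j ≤ T.length → IsCandidateList (bwt T SA) (lcp T SA) j E N cand → N ≤ m)
    (hj1 : 1 ≤ j) (hj2 : j < T.length) (h : ScanInvariant T SA σ m j D N idx cand r F)
    (H : ∀ r' F' D' N' idx' cand', ScanInvariant T SA σ m (j + 1) D' N' idx' cand' r' F' →
      Reach (inputStream T SA) M W (K + 4 * D') (cfg 4 r' F' (j + 1) []) Q) :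
    Reach (inputStream T SA) M W (K + 4 * D + 100) (cfg 4 r F j []) Q := by
  have hlen := h.len
  have hL : ∀ i, -(T.length : ℤ) ≤ lcp T SA i ∧ lcp T SA i ≤ T.length := fun i =>
    abs_le.1 (abs_lcp_le hT i)
  have hLj := hL (j + 1)
  have hsa1 := sa_mem hT hSA hj1 hj2.le
  have hsa2 := sa_mem hT hSA (show 1 ≤ j + 1 by omega) hj2
  have hb1 := bwt_mem hT hSA hj1 hj2.le
  have hb2 := bwt_mem hT hSA (show 1 ≤ j + 1 by omega) hj2
  have hDm : D ≤ m := (h.stack.depth_le_height hT hSA hj1 hj2.le).trans hdepth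
  refine .jumpEQ rfl (.reg h.index) (.reg hlen) (fun hc => by omega) (fun _ => ?_)
  refine .add rfl (.reg h.index) (.const 1) (by omega) ?_
  refine .read rfl (inputStream_of_mem .lcp (by simp) (by simpa using hj2)) (by simp; omega) ?_
  refine .read rfl (inputStream_of_mem .bwt (by simpa using hj1) (by simpa using hj2.le))
    (by simp; omega) ?_
  refine .read rfl (inputStream_of_mem .bwt (by simp) (by simpa using hj2)) (by simp; omega) ?_
  refine .read rfl (inputStream_of_mem .sa (by simpa using hj1) (by simpa using hj2.le))
    (by simp; omega) ?_
  refine .read rfl (inputStream_of_mem .sa (by simp) (by simpa using hj2)) (by simp; omega) ?_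
  refine .advance rfl ?_
  simp only [if_true, Bool.false_eq_true, if_false]
  refine .mono (K := K + 90 + 4 * D + 2) ?_ (by omega)
  refine reach_pop (ℓ := lcp T SA (j + 1)) hm hW h.stack.one_le hDm (by simp; exact h.top)
    (by simp) (fun d h1 h2 => (h.represents.stack d h1 h2).2) ?_
    fun r₁ D' hr₁ htop h1 h2 h3 h4 => ?_
  · rw [h.stack.first, lcp_one]
    have := lcp_nonneg (T := T) (SA := SA) (show j + 1 ≠ 1 by omega)
    omega
  have hst := h.stack.push h1 h2 h3 h4
  have hrep := h.represents.push h.stack h2 h4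
  have hDm' := (hst.depth_le_height hT hSA (by omega) hj2).trans hdepth
  have hidx := h.stack.idx_le h1 h2
  refine .mono (K := K + 4 * D' + 83 + 7) ?_ (by omega)
  refine reach_push (j := j + 1) (idx := idx) hm hW hn h1 hDm' hj2 hLj (by omega) htop
    (by simp [hr₁]) (by simp [hr₁]) (h.represents.stack D' h1 h2).1
    fun r₂ hr₂ htop₂ hprev => ?_
  have hfr₂ : ∀ a, a ≠ 2 → a ≠ 5 → a ≠ 12 → a ≠ 4 → a ≠ 6 → a ≠ 7 → a ≠ 8 → a ≠ 13 → a ≠ 10 →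
      r₂ a = r a := by
    intro a h2 h5 h12 h4 h6 h7 h8 h13 h10
    simp [hr₂, hr₁, h2, h5, h12, h4, h6, h7, h8, h13, h10]
  have h6 : r₂ 6 = bwt T SA j := by simp [hr₂, hr₁]
  have h7 : r₂ 7 = bwt T SA (j + 1) := by simp [hr₂, hr₁]
  refine .jumpEQ rfl (.reg h6) (.reg h7) ?_ ?_
  · intro heq
    refine .mono (H r₂ _ (D' + 1) N _ cand ⟨?_, ?_, htop₂, ?_, ?_, hst, hrep,
      (h.candidates.mono_time (by omega)).congr_events fun i c hE => ⟨hE.1, ?_⟩⟩) (by omega)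
    · simp [hfr₂, h.len]
    · simp [hfr₂, h.alphabet]
    · simp [hfr₂, h.node]
    · simp [hr₂, hr₁]
    · rcases hE.2.eq_or_lt with rfl | hlt
      · exact absurd (by simpa using heq) hE.1.2.2.1
      · omega
  intro hne
  have hne' : bwt T SA (j + 1 - 1) ≠ bwt T SA (j + 1) := by simpa using hne
  have hprev' : r₂ 12 = Function.update idx (D' + 1) (j + 1) (D' + 1 - 1) := by
    rw [hprev, Function.update_of_ne (by omega)]; rfl
  -- the two events of `j + 1`: the character at `j`, then the one at `j + 1`
  refine .move rfl (.const 0) (by omega) ?_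
  refine .mono (K := K + 4 * D' + 45 + 34) ?_ (by omega)
  refine reach_event (j := j + 1) (p := j) (c := bwt T SA j) hm hW hn hL hσ hsa1.2
    (fun E N cand => hN (j + 1) E N cand hj2) (by simp [hfr₂, h.len]) (by simpa using htop₂)
    (by simpa [hfr₂] using h.node) (by simp [hr₂, hr₁]) (by simp [h6]) (by simp [hr₂, hr₁])
    (by simp [hr₂, hr₁]) (by simpa using hprev') hst (by omega) hDm' hj2 hrep
    (h.candidates.mono_time (by omega)) hb1 hne' (Or.inr rfl) rfl ?_
  intro r₃ F₃ N₃ cand₃ hr₃ hnode₃ hrep₃ hcand₃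
  refine .jumpEQ rfl (.reg (v := 0) (by simp [hr₃])) (.const 1) (fun hc => by omega)
    (fun _ => ?_)
  refine .move rfl (.const 1) (by omega) ?_
  refine .move rfl (.reg (v := bwt T SA (j + 1)) (by simp [hr₃, h7])) (by omega) ?_
  refine .move rfl (.reg (v := SA (j + 1)) (by simp [hr₃, hr₂, hr₁])) (by omega) ?_
  refine .goto rfl ?_
  refine .mono (K := K + 4 * D' + 5 + 34) ?_ (by omega)
  refine reach_event (j := j + 1) (p := j + 1) (c := bwt T SA (j + 1)) hm hW hn hL hσ hsa2.2
    (fun E N cand => hN (j + 1) E N cand hj2) (by simp [hr₃, hfr₂, h.len])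
    (by simpa [hr₃] using htop₂)
    (by simpa using hnode₃) (by simp [hr₃, hr₂, hr₁]) (by simp) (by simp)
    (by simp [hr₃, hr₂, hr₁]) (by simpa [hr₃] using hprev') hst (by omega) hDm' hj2 hrep₃
    hcand₃ hb2 hne' (Or.inl rfl) rfl ?_
  intro r₄ F₄ N₄ cand₄ hr₄ hnode₄ hrep₄ hcand₄
  refine .jumpEQ rfl (.reg (v := 1) (by simp [hr₄])) (.const 1) (fun _ => ?_)
    (fun hc => absurd rfl hc)
  refine .mono (H r₄ F₄ (D' + 1) N₄ _ cand₄ ⟨?_, ?_, ?_, hnode₄, ?_, hst, hrep₄,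
    hcand₄.congr_events fun i c hE => ?_⟩) (K := K + 4 * (D' + 1)) ?_
  · simp [hr₄, hr₃, hfr₂, h.len]
  · simp [hr₄, hr₃, hfr₂, h.alphabet]
  · simpa [hr₄, hr₃] using htop₂
  · simp [hr₄, hr₃, hr₂, hr₁]
  · rcases hE.2.eq_or_lt with rfl | hlt
    · rcases hE.1.2.2.2 with hc | hc
      · exact Or.inl (Or.inr ⟨rfl, hc⟩)
      · exact Or.inr ⟨rfl, hc⟩
    · exact Or.inl (Or.inl ⟨hE.1, by omega⟩)
  · omega

end

section
variable {σ M W K m j D N : ℕ} {T : List ℕ} {SA : ℕ → ℕ} {r : ℕ → ℤ} {F : ℕ → ℕ → ℤ}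
  {Q : MState → Prop} {idx : ℕ → ℕ} {cand : ℕ → Candidate}

/-- The whole scan: at most `100` steps for each index that remains, `4` for each stack entry. -/
lemma reach_scan (hT : IsText σ T) (hSA : IsSuffixArray (revText T) SA) (hm : m ≤ M)
    (hW : 16 * (m + 1) ≤ W) (hn : T.length + 1 ≤ W) (hσ : σ ≤ m)
    (hdepth : suffixTreeHeight (revText T) + 1 ≤ m)
    (hN : ∀ j E N cand, j ≤ T.length → IsCandidateList (bwt T SA) (lcp T SA) j E N cand → N ≤ m)
    (hj1 : 1 ≤ j) (hj2 : j ≤ T.length) (h : ScanInvariant T SA σ m j D N idx cand r F)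
    (H : ∀ r' F' D' N' idx' cand', ScanInvariant T SA σ m T.length D' N' idx' cand' r' F' →
      Reach (inputStream T SA) M W K (cfg 64 r' F' T.length []) Q) :
    Reach (inputStream T SA) M W (K + 1 + 4 * D + 100 * (T.length - j)) (cfg 4 r F j []) Q := by
  induction hj2 using Nat.decreasingInduction generalizing D N idx cand r F with
  | self =>
    refine .mono (K := K + 1) ?_ (by omega)
    exact .jumpEQ rfl (.reg h.index) (.reg h.len) (fun _ => H _ _ _ _ _ _ h)
      (fun hc => absurd rfl hc)
  | of_succ j hj ih =>
    refine .mono (K := K + 1 + 100 * (T.length - (j + 1)) + 4 * D + 100) ?_ (by omega)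
    refine reach_next hT hSA hm hW hn hσ hdepth hN hj1 hj h fun r' F' D' N' idx' cand' h' => ?_
    exact .mono (ih (by omega) h') (by omega)

/-! ### The output -/

/-- The output: for each character in turn, the text positions of its candidates. -/
def outputList (T : List ℕ) (SA : ℕ → ℕ) (σ N : ℕ) (cand : ℕ → Candidate) : List ℕ :=
  ((List.range' 1 σ).flatMap fun c => (List.range' 1 N).filter fun k => (cand k).char = c).map
    fun k => T.length + 1 - SA (cand k).pos

lemma candidate_mem (hT : IsText σ T) (hSA : IsSuffixArray (revText T) SA)
    {E : ℕ → ℕ → Prop} (h : IsCandidateList (bwt T SA) (lcp T SA) j E N cand) (hj : j ≤ T.length)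
    {k : ℕ} (h1 : 1 ≤ k) (h2 : k ≤ N) :
    1 ≤ (cand k).pos ∧ (cand k).pos ≤ T.length ∧ 1 ≤ (cand k).char ∧ (cand k).char ≤ σ := by
  obtain ⟨h3, h4⟩ := h.pos_mem h1 h2
  have h5 := bwt_mem hT hSA h3 (h4.trans hj)
  rw [h.char_eq k h1 h2] at h5
  exact ⟨h3, h4.trans hj, h5⟩

lemma mem_outputList (hT : IsText σ T) (hSA : IsSuffixArray (revText T) SA)
    {E : ℕ → ℕ → Prop} (h : IsCandidateList (bwt T SA) (lcp T SA) j E N cand) (hj : j ≤ T.length)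
    {x : ℕ} : x ∈ outputList T SA σ N cand ↔
      ∃ k, 1 ≤ k ∧ k ≤ N ∧ x = T.length + 1 - SA (cand k).pos := by
  simp only [outputList, List.mem_map, List.mem_flatMap, List.mem_filter, List.mem_range'_1,
    decide_eq_true_eq]
  constructor
  · rintro ⟨k, ⟨c, -, hk, -⟩, rfl⟩
    exact ⟨k, hk.1, by omega, rfl⟩
  · rintro ⟨k, h1, h2, rfl⟩
    have := candidate_mem hT hSA h hj h1 h2
    exact ⟨k, ⟨(cand k).char, by omega, by omega, rfl⟩, rfl⟩

/-- Every suffixient set has an element in the box of each candidate, and these boxes are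
disjoint. -/
lemma IsSuffixient.le_card (hT : IsText σ T) (hSA : IsSuffixArray (revText T) SA)
    {E : ℕ → ℕ → Prop} (h : IsCandidateList (bwt T SA) (lcp T SA) j E N cand) (hj : j ≤ T.length)
    {Y : Finset ℕ} (hY : IsSuffixient T Y) : N ≤ Y.card := by
  set Y' := (Finset.Icc 1 T.length).filter fun i => T.length + 1 - SA i ∈ Y
  have h1 : N ≤ Y'.card := by
    refine h.card_le fun k h1 h2 => ?_
    have hpos := h.pos_eq k h1 h2
    obtain ⟨i, hi1, hi2, hi3, hi4, hi5⟩ := hY.exists_inBox hT hSA (j := (cand k).event)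
      (c := (cand k).char) ⟨h.event_ge k h1 h2, (h.event_le k h1 h2).trans hj, h.change k h1 h2, by
        rw [← h.char_eq k h1 h2]; rcases hpos with hp | hp <;> rw [hp] <;> simp⟩
    exact ⟨i, by simp [Y', hi1, hi2, hi3], hi4, hi5⟩
  refine h1.trans (Finset.card_le_card_of_injOn (fun i => T.length + 1 - SA i)
    (fun i hi => (Finset.mem_filter.1 hi).2) ?_)
  intro a ha b hb hab
  have ha' := Finset.mem_Icc.1 (Finset.mem_filter.1 ha).1
  have hb' := Finset.mem_Icc.1 (Finset.mem_filter.1 hb).1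
  have h2 := sa_mem hT hSA ha'.1 ha'.2
  have h3 := sa_mem hT hSA hb'.1 hb'.2
  refine hSA.1.injOn ?_ ?_ (show SA a = SA b by simp only at hab; omega)
  · rw [length_revText hT]; exact ha'
  · rw [length_revText hT]; exact hb'

/-- `T[1..x]` is compared by its last character first and then by the reversed prefix before
it, that is, by character and then by index. -/
lemma outputList_pairwise (hT : IsText σ T) (hSA : IsSuffixArray (revText T) SA)
    {E : ℕ → ℕ → Prop} (h : IsCandidateList (bwt T SA) (lcp T SA) j E N cand)
    (hj : j ≤ T.length) :
    (outputList T SA σ N cand).Pairwise fun x y => ColexLT (T.take x) (T.take y) := by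
  have key : ∀ k, 1 ≤ k → k ≤ N → (T.take (T.length + 1 - SA (cand k).pos)).reverse =
      (cand k).char :: revPrefix T SA (cand k).pos := fun k h1 h2 => by
    have := candidate_mem hT hSA h hj h1 h2
    rw [take_succ_eq hT hSA this.1 this.2.1, h.char_eq k h1 h2]
  rw [outputList, List.pairwise_map, List.pairwise_flatMap]
  constructor
  · intro c _
    refine (List.Pairwise.filter _ (List.pairwise_lt_range' (s := 1) (n := N))).imp_of_mem ?_
    intro a b ha hb hab
    simp only [List.mem_filter, List.mem_range'_1, decide_eq_true_eq] at ha hb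
    rw [ColexLT, key a ha.1.1 (by omega), key b hb.1.1 (by omega), List.cons_lt_cons_iff]
    refine Or.inr ⟨ha.2.trans hb.2.symm, ?_⟩
    exact revPrefix_lt hT hSA (candidate_mem hT hSA h hj ha.1.1 (by omega)).1
      (h.pos_lt ha.1.1 hab (by omega) (ha.2.trans hb.2.symm))
      (candidate_mem hT hSA h hj hb.1.1 (by omega)).2.1
  · refine (List.pairwise_lt_range' (s := 1) (n := σ)).imp ?_
    intro c c' hc a ha b hb
    simp only [List.mem_filter, List.mem_range'_1, decide_eq_true_eq] at ha hb
    rw [ColexLT, key a ha.1.1 (by omega), key b hb.1.1 (by omega), List.cons_lt_cons_iff]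
    exact Or.inl (by omega)

lemma card_outputList_le (hT : IsText σ T) (hSA : IsSuffixArray (revText T) SA)
    {E : ℕ → ℕ → Prop} (h : IsCandidateList (bwt T SA) (lcp T SA) j E N cand)
    (hj : j ≤ T.length) : (outputList T SA σ N cand).toFinset.card ≤ N := by
  have : (outputList T SA σ N cand).toFinset ⊆
      (Finset.Icc 1 N).image fun k => T.length + 1 - SA (cand k).pos := by
    intro x hx
    obtain ⟨k, h1, h2, rfl⟩ := (mem_outputList hT hSA h hj).1 (List.mem_toFinset.1 hx)
    exact Finset.mem_image.2 ⟨k, Finset.mem_Icc.2 ⟨h1, h2⟩, rfl⟩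
  exact (Finset.card_le_card this).trans (Finset.card_image_le.trans (by simp))

lemma length_outputList (hT : IsText σ T) (hSA : IsSuffixArray (revText T) SA)
    {E : ℕ → ℕ → Prop} (h : IsCandidateList (bwt T SA) (lcp T SA) j E N cand)
    (hj : j ≤ T.length) :
    (outputList T SA σ N cand).length = (outputList T SA σ N cand).toFinset.card := by
  rw [List.toFinset_card_of_nodup]
  refine (outputList_pairwise hT hSA h hj).imp ?_
  rintro x y hxy rfl
  exact lt_irrefl _ hxy

lemma outputList_isSuffixientArray (hT : IsText σ T) (hSA : IsSuffixArray (revText T) SA)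
    (h : IsCandidateList (bwt T SA) (lcp T SA) T.length
      (fun i c => IsEvent T SA i c ∧ i ≤ T.length) N cand) :
    IsSuffixientArray T (outputList T SA σ N cand) := by
  refine ⟨isSuffixient_of_inBox hT hSA ?_ fun i c hE => ?_, fun Y hY => ?_,
    outputList_pairwise hT hSA h le_rfl⟩
  · intro x hx
    obtain ⟨k, h1, h2, rfl⟩ := (mem_outputList hT hSA h le_rfl).1 (List.mem_toFinset.1 hx)
    have h3 := candidate_mem hT hSA h le_rfl h1 h2
    have := sa_mem hT hSA h3.1 h3.2.1
    exact Finset.mem_Icc.2 (by omega)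
  · obtain ⟨k, h1, h2, h3, h4⟩ := h.cover i c ⟨hE, hE.2.1⟩
    have h5 := candidate_mem hT hSA h le_rfl h1 h2
    refine ⟨(cand k).pos, h5.1, h5.2.1, ?_, by rw [h.char_eq k h1 h2, h3], fun q hq => ?_⟩
    · exact List.mem_toFinset.2 ((mem_outputList hT hSA h le_rfl).2 ⟨k, h1, h2, rfl⟩)
    · have := h.pos_eq k h1 h2
      have := h.event_ge k h1 h2
      exact h4 q (by omega)
  · exact (card_outputList_le hT hSA h le_rfl).trans (hY.le_card hT hSA h le_rfl)

/-- From the end of the scan on, the program writes the output list. -/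
lemma reach_output (hT : IsText σ T) (hSA : IsSuffixArray (revText T) SA) (hm : m ≤ M)
    (hW : 16 * (m + 1) ≤ W) (hσ : σ ≤ m) (hN : N ≤ m)
    (h : ScanInvariant T SA σ m T.length D N idx cand r F)
    (H : ∀ s : MState, program[s.pc]? = some .halt →
      s.out = (outputList T SA σ N cand).map (Nat.cast : ℕ → ℤ) → Q s) :
    Reach (inputStream T SA) M W (4 + 7 * σ + 15 * N) (cfg 64 r F T.length []) Q := by
  have hcand := h.candidates
  set ls : ℕ → List ℕ := fun c => (List.range' 1 N).filter fun k => (cand k).char = c with hls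
  have hmem : ∀ a ∈ (List.range' 1 σ).flatMap ls, 1 ≤ a ∧ a ≤ N := fun a ha => by
    simp only [hls, List.mem_flatMap, List.mem_filter, List.mem_range'_1] at ha
    obtain ⟨c, -, ha, -⟩ := ha
    omega
  have hlen : ((List.range' 1 σ).flatMap ls).length ≤ N := by
    have := length_outputList hT hSA hcand le_rfl
    rw [outputList, List.length_map] at this
    exact this.le.trans (card_outputList_le hT hSA hcand le_rfl)
  refine .mono (K := 2 + 7 * σ + 6 * N + 1 + 1 + 9 * N) ?_ (by omega)
  refine reach_link (σ := σ) (char := fun k => (cand k).char) hm hW hN le_rfl hσ h.node ?_ ?_ ?_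
  · intro a h1 h2
    have := candidate_mem hT hSA hcand le_rfl h1 h2
    exact ⟨this.2.2.1, this.2.2.2, (h.represents.node a h1 h2).2⟩
  · intro c _ _
    simpa [IsLinked] using h.represents.head c
  · intro r' F' hr' hF' hlink
    refine .move rfl (.const 0) (by omega) ?_
    refine .mono (K := 2 + 7 * σ + 6 * ((List.range' (0 + 1) σ).flatMap ls).length) ?_
      (by simpa using hlen)
    refine reach_write_all (ls := ls) hm hW (zero_add σ) hσ (by simp [hr', h.alphabet]) (by simp)
      hlink ?_ fun s hs ho => H s hs ?_
    · intro c h1 h2 a ha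
      have := hmem a (List.mem_flatMap.2 ⟨c, List.mem_range'_1.2 (by omega), ha⟩)
      omega
    · rw [ho, outputList, List.map_map, List.nil_append]
      refine List.map_congr_left fun a ha => ?_
      have ha' := hmem a ha
      have h1 := candidate_mem hT hSA hcand le_rfl ha'.1 ha'.2
      have h2 := sa_mem hT hSA h1.1 h1.2.1
      rw [hF', (h.represents.node a ha'.1 ha'.2).1, Function.comp_apply]
      omega

end

lemma suffixTreeHeight_le (S : List ℕ) : suffixTreeHeight S ≤ S.length + 1 := by
  rw [suffixTreeHeight]
  rcases Set.eq_empty_or_nonempty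
    {k | ∃ v, IsLeaf S v ∧ k = Set.ncard {u | u <+: v ∧ IsBranchingNode S u}} with h | h
  · rw [h]; simp
  · exact csSup_le h (length_mem_upperBounds_branching_depths S)

lemma exists_minimal_isSuffixient {σ : ℕ} {T : List ℕ} {SA : ℕ → ℕ} (hT : IsText σ T)
    (hSA : IsSuffixArray (revText T) SA) :
    ∃ X, IsSuffixient T X ∧ ∀ Y, IsSuffixient T Y → X.card ≤ Y.card := by
  have hne : {X | IsSuffixient T X}.Nonempty := by
    refine ⟨Finset.Icc 1 T.length, isSuffixient_of_inBox hT hSA subset_rfl fun j c hE => ?_⟩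
    obtain ⟨hj1, hj2, -, rfl | rfl⟩ := hE
    · have := sa_mem hT hSA (show 1 ≤ j - 1 by omega) (by omega)
      exact ⟨j - 1, by omega, by omega, Finset.mem_Icc.2 (by omega), rfl, fun k hk => by
        rw [show k = j by omega]⟩
    · have := sa_mem hT hSA (show 1 ≤ j by omega) (by omega)
      exact ⟨j, by omega, by omega, Finset.mem_Icc.2 (by omega), rfl, fun k hk => by omega⟩
  exact ⟨Function.argminOn Finset.card _ hne, Function.argminOn_mem _ _ hne, fun Y hY =>
    Function.argminOn_le Finset.card {X | IsSuffixient T X} hY⟩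

lemma initialState_eq (n σ : ℕ) : initialState n σ =
    cfg 0 (fun a => if a = 0 then (n : ℤ) else if a = 1 then (σ : ℤ) else 0) (fun _ _ => 0) 1
      [] := by
  rw [initialState, cfg]
  congr 1
  funext a
  rw [layout]
  split_ifs <;> first | rfl | omega

/-- The program started on an input of length `n`, with memory for `m` records, where `m` bounds
the size of the alphabet, the depth of the stack and the number of nodes. -/
lemma reach_program {σ m M W : ℕ} {T : List ℕ} {SA : ℕ → ℕ} {Q : MState → Prop}
    (hT : IsText σ T) (hSA : IsSuffixArray (revText T) SA) (hm : m ≤ M)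
    (hW : 16 * (m + 1) ≤ W) (hn : T.length + 1 ≤ W) (hσ : σ ≤ m)
    (hdepth : suffixTreeHeight (revText T) + 1 ≤ m)
    (hN : ∀ j E N cand, j ≤ T.length → IsCandidateList (bwt T SA) (lcp T SA) j E N cand →
      N ≤ m ∧ N ≤ T.length)
    (H : ∀ (s : MState) N cand, program[s.pc]? = some .halt →
      IsCandidateList (bwt T SA) (lcp T SA) T.length
        (fun i c => IsEvent T SA i c ∧ i ≤ T.length) N cand →
      s.out = (outputList T SA σ N cand).map (Nat.cast : ℕ → ℤ) → Q s) :
    Reach (inputStream T SA) M W (115 * T.length + 7 * σ + 13)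
      (initialState T.length σ) Q := by
  have hlen := hT.two_le_length
  rw [initialState_eq]
  refine .mono (K := 4 + 7 * σ + 15 * T.length + 1 + 4 * 1 + 100 * (T.length - 1) + 4) ?_
    (by omega)
  refine .move rfl (.const 16) (by omega) ?_
  refine .store_dir 1 5 rfl (.const 1) (by omega) (by omega) ?_
  refine .store_dir 1 6 rfl (.const (-1)) (by omega) (by omega) ?_
  refine .move rfl (.const 1) (by omega) ?_
  refine reach_scan (idx := fun _ => 1) (N := 0) (cand := fun _ => ⟨0, 0, 0⟩) hT hSA hm hW hn hσ
    hdepth (fun j E N cand hj h => (hN j E N cand hj h).1) le_rfl (by omega) ?_ ?_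
  · refine ⟨by simp, by simp, by simp, by simp, by simp, .singleton _ rfl, ⟨?_, ?_, ?_, ?_⟩,
      (IsCandidateList.empty _ _ _ _).congr_events fun i c h => ?_⟩
    · intro d h1 h2
      obtain rfl : d = 1 := by omega
      simp [lcp_one]
    · intro k h1 h2; omega
    · simp
    · intro c _ _
      exact Or.inl ⟨by simp, fun k h1 h2 => by omega⟩
    · have := h.1.1; omega
  · intro r' F' D' N' idx' cand' h
    have hN' := hN _ _ _ _ le_rfl h.candidates
    refine .mono (K := 4 + 7 * σ + 15 * N') ?_ (by omega)
    exact reach_output hT hSA hm hW hσ hN'.1 h fun s hs ho => H s N' cand' hs h.candidates ho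

end Suffixient

theorem mainTheorem1 :
    ∃ (P : Suffixient.Program) (C : ℕ),
      ∀ (σ : ℕ) (T : List ℕ) (SA : ℕ → ℕ),
        Suffixient.IsText σ T →
        Suffixient.IsSuffixArray (Suffixient.revText T) SA →
        ∃ sA : List ℕ,
          Suffixient.IsSuffixientArray T sA ∧
          Suffixient.Computes P (Suffixient.inputStream T SA) T.length σ
            (C * T.length)
            (C * (sA.length + Suffixient.suffixTreeHeight (Suffixient.revText T)))
            (C * T.length)
            (sA.map (Nat.cast : ℕ → ℤ)) := by
  refine ⟨Suffixient.program, 160, fun σ T SA hT hSA => ?_⟩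
  obtain ⟨X, hX, hmin⟩ := Suffixient.exists_minimal_isSuffixient hT hSA
  have hσX := hX.alphabet_le_card hT
  have hσ := hT.1
  have hlen := hT.two_le_length
  have hXn : X.card ≤ T.length := by simpa using Finset.card_le_card hX.1
  have hh := Suffixient.suffixTreeHeight_le (Suffixient.revText T)
  rw [Suffixient.length_revText hT] at hh
  set h := Suffixient.suffixTreeHeight (Suffixient.revText T) with hh_def
  -- `160 = 16 * 10`: a record has `16` cells, and the factor `10` makes the bounds on time and word
  -- size large enough; of the `10 * (X.card + h) - 1` records, at most `X.card + h` are used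
  obtain ⟨t, ht, s, hrun, sA, hsA, hhalt, hout⟩ := Suffixient.reach_program (m := X.card + h)
    (M := 10 * (X.card + h) - 1) (W := 160 * T.length)
    (Q := fun s => ∃ sA : List ℕ, Suffixient.IsSuffixientArray T sA ∧
      Suffixient.program[s.pc]? = some .halt ∧ s.out = sA.map (Nat.cast : ℕ → ℤ))
    hT hSA (by omega) (by omega) (by omega) (by omega) (by omega)
    (fun j E N cand hj hc => by have := hX.le_card hT hSA hc hj; omega)
    (fun s N cand hs hc ho => ⟨_, Suffixient.outputList_isSuffixientArray hT hSA hc, hs, ho⟩)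
  have hnodup : sA.Nodup := hsA.2.2.imp (by rintro x y hxy rfl; exact lt_irrefl _ hxy)
  have hcard : sA.length = X.card := by
    rw [← List.toFinset_card_of_nodup hnodup]
    exact le_antisymm (hsA.2.1 X hX) (hmin _ hsA.1)
  refine ⟨sA, hsA, t, by omega, s, ?_, hhalt, hout⟩
  rwa [hcard, show 160 * (X.card + h) = 16 * (10 * (X.card + h) - 1 + 1) by omega]
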